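/- Let $k$ be a field and let $Q=(Q_0,Q_1)$ be a locally finite quiver, i.e. only finitely many arrows start and only finitely many arrows end at each vertex ($Q_0$ may be infinite). Let $kQ$ be the path algebra (paths are composed from right to left), write $kQ_n$ for the span of the paths of length $n$ and $kQ_n(x,y)$ for the span of the paths of length $n$ from $x$ to $y$. Let $R$ be a quadratic ideal of $kQ$, i.e. a two-sided ideal generated by a set of elements each lying in some $kQ_2(x,y)$, and let $\Lambda=kQ/R$, with idempotents $e_x$ ($x\in Q_0$), grading $\Lambda=\bigoplus_{n\ge 0}\Lambda_n$ by path length, and $J$ the ideal generated by the classes of the arrows. Modules are left modules. Put $P_x=\Lambda e_x$, graded by the subspaces $\Lambda_n e_x$, and $S_a=\Lambda e_a/Je_a$. The algebra $\Lambda$ is called Koszul if for every $a\in Q_0$ the simple module $S_a$ has a linear projective resolution, i.e. there is an exact sequence $$\cdots\to P^{-n}\xrightarrow{d^{-n}}P^{-n+1}\to\cdots\to P^{-1}\xrightarrow{d^{-1}}P^0\xrightarrow{d^0}S_a\to 0$$ of $\Lambda$-modules in which every $P^{-n}$ is a finite direct sum of modules $P_x$, $\ker d^{-n}\subseteq JP^{-n}$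 for all $n\ge 0$, and $d^{-n}$ is homogeneous of degree one for all $n\ge 1$. Let $Q^{\mathrm o}$ be the opposite quiver and $\gamma\mapsto\gamma^{\mathrm o}$ the linear map $kQ\to kQ^{\mathrm o}$ reversing paths. For $\rho=\sum_p\rho_p\,p$ in $kQ_2(x,y)$ (sum over paths $p$) let $\rho^*$ be the linear form $\sum_p\gamma_p\,p\mapsto\sum_p\rho_p\gamma_p$. The quadratic dual of $\Lambda$ is $\Lambda^!=kQ^{\mathrm o}/R^!$, where $R^!$ is the two-sided ideal of $kQ^{\mathrm o}$ generated by all $\rho^{\mathrm o}$ such that, for some $x,y\in Q_0$, $\rho\in kQ_2(x,y)$ and $\rho^*$ vanishes on $R\cap kQ_2(x,y)$. It is again the quotient of the path algebra of a locally finite quiver by a quadratic ideal. Then $\Lambda$ is Koszul if and only if $\Lambda^!$ is Koszul. -/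

import Mathlib

universe u v w

namespace BoundQuiver

noncomputable section

open Classical

/-- A quiver is locally finite if only finitely many arrows start, and only finitely many arrows
end, at each vertex. -/
def LocallyFinite (Q : Type u) [Quiver.{v} Q] : Prop :=
  ∀ x : Q, Finite (Quiver.Star x) ∧ Finite (Quiver.Costar x)

/-! ### Paths -/

/-- The paths of a quiver, with arbitrary source and target. -/
abbrev QPath (Q : Type u) [Quiver.{v} Q] : Type (max u v) := Σ x y : Q, Quiver.Path x y

namespace QPath

variable {Q : Type u} [Quiver.{v} Q]

/-- The starting vertex of a path. -/
def source (p : QPath Q) : Q := p.1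

/-- The end vertex of a path. -/
def target (p : QPath Q) : Q := p.2.1

/-- The number of arrows of a path. -/
def length (p : QPath Q) : ℕ := p.2.2.length

/-- The trivial path at a vertex. -/
def trivial (x : Q) : QPath Q := ⟨x, x, Quiver.Path.nil⟩

/-- An arrow, as a path of length one. -/
def ofArrow {x y : Q} (α : x ⟶ y) : QPath Q := ⟨x, y, α.toPath⟩

/-- The path `p q`: first `q`, then `p`. Paths are composed from right to left. -/
def comp (p q : QPath Q) (h : q.target = p.source) : QPath Q :=
  ⟨q.1, p.2.1, q.2.2.comp (p.2.2.cast h.symm rfl)⟩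

/-- The reversed path in the opposite quiver, whose vertices are those of `Q`, wrapped by `op`, and
which has an arrow `α.op : op y ⟶ op x` for each arrow `α : x ⟶ y` of `Q`. -/
def opPath {x : Q} : {y : Q} → Quiver.Path x y → Quiver.Path (Opposite.op y) (Opposite.op x)
  | _, Quiver.Path.nil => Quiver.Path.nil
  | _, Quiver.Path.cons p α => (Quiver.Hom.toPath α.op).comp (opPath p)

/-- The path of the opposite quiver that corresponds to a path. -/
def op (p : QPath Q) : QPath Qᵒᵖ := ⟨Opposite.op p.2.1, Opposite.op p.1, opPath p.2.2⟩

end QPath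

/-! ### The path algebra -/

/-- The path algebra `kQ`: the vector space with the paths of `Q` as a basis. It is an associative
algebra, with a unit only if `Q` has finitely many vertices. -/
def PathAlgebra (k : Type w) [Field k] (Q : Type u) [Quiver.{v} Q] : Type (max u v w) :=
  QPath Q →₀ k

namespace PathAlgebra

variable {k : Type w} [Field k] {Q : Type u} [Quiver.{v} Q]

instance : AddCommGroup (PathAlgebra k Q) := inferInstanceAs (AddCommGroup (QPath Q →₀ k))

instance : Module k (PathAlgebra k Q) := inferInstanceAs (Module k (QPath Q →₀ k))

/-- The identification of `kQ` with the finitely supported functions on paths. -/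
def toFinsupp : PathAlgebra k Q ≃ₗ[k] (QPath Q →₀ k) := LinearEquiv.refl k _

variable (k) in
/-- The basis element of `kQ` given by a path. -/
def ofPath (p : QPath Q) : PathAlgebra k Q := toFinsupp.symm (Finsupp.single p 1)

/-- The product of two paths in `kQ`: their composite if they are composable, and zero if not. -/
def pathMul (p q : QPath Q) : PathAlgebra k Q :=
  if h : q.target = p.source then ofPath k (p.comp q h) else 0

/-- The bilinear extension of the product of paths. -/
def mulBilin : PathAlgebra k Q →ₗ[k] PathAlgebra k Q →ₗ[k] PathAlgebra k Q :=
  (Finsupp.linearCombination k fun p : QPath Q =>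
    (Finsupp.linearCombination k fun q : QPath Q => (pathMul p q : PathAlgebra k Q)) ∘ₗ
      toFinsupp.toLinearMap) ∘ₗ toFinsupp.toLinearMap

instance : Mul (PathAlgebra k Q) := ⟨fun f g => mulBilin f g⟩

theorem mul_def (f g : PathAlgebra k Q) : f * g = mulBilin f g := rfl

theorem ofPath_mul_ofPath (p q : QPath Q) : ofPath k p * ofPath k q = pathMul p q := by
  simp [mul_def, mulBilin, ofPath]

theorem zero_mul' (f : PathAlgebra k Q) : 0 * f = 0 := by simp [mul_def]

theorem mul_zero' (f : PathAlgebra k Q) : f * 0 = 0 := by simp [mul_def]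

/-- Linear maps out of `kQ` that agree on paths are equal. -/
theorem linearMap_ext {M : Type*} [AddCommMonoid M] [Module k M] {f g : PathAlgebra k Q →ₗ[k] M}
    (h : ∀ p, f (ofPath k p) = g (ofPath k p)) : f = g := by
  have h2 : f ∘ₗ toFinsupp.symm.toLinearMap = g ∘ₗ toFinsupp.symm.toLinearMap := by
    refine Finsupp.lhom_ext' fun p => LinearMap.ext_ring ?_
    exact h p
  ext x
  exact LinearMap.congr_fun h2 (toFinsupp x)

theorem pathMul_assoc (p q r : QPath Q) :
    (pathMul p q : PathAlgebra k Q) * ofPath k r = ofPath k p * pathMul q r := by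
  obtain ⟨p₁, p₂, p⟩ := p
  obtain ⟨q₁, q₂, q⟩ := q
  obtain ⟨r₁, r₂, r⟩ := r
  by_cases h₁ : q₂ = p₁
  · subst h₁
    by_cases h₂ : r₂ = q₁
    · subst h₂
      simp [pathMul, QPath.comp, QPath.target, QPath.source, ofPath_mul_ofPath,
        Quiver.Path.comp_assoc]
    · simp [pathMul, QPath.comp, QPath.target, QPath.source, ofPath_mul_ofPath, h₂, mul_zero']
  · by_cases h₂ : r₂ = q₁
    · subst h₂
      simp [pathMul, QPath.comp, QPath.target, QPath.source, ofPath_mul_ofPath, h₁, zero_mul']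
    · simp [pathMul, QPath.target, QPath.source, h₁, h₂, zero_mul', mul_zero']

theorem mul_assoc' (f g h : PathAlgebra k Q) : f * g * h = f * (g * h) := by
  let L : PathAlgebra k Q →ₗ[k] PathAlgebra k Q →ₗ[k] PathAlgebra k Q →ₗ[k] PathAlgebra k Q :=
    mulBilin.compr₂ mulBilin
  let R : PathAlgebra k Q →ₗ[k] PathAlgebra k Q →ₗ[k] PathAlgebra k Q →ₗ[k] PathAlgebra k Q :=
    (LinearMap.llcomp k _ _ _ ∘ₗ mulBilin).compl₂ mulBilin
  have hLR : L = R := by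
    refine linearMap_ext fun p => linearMap_ext fun q => linearMap_ext fun r => ?_
    change ofPath k p * ofPath k q * ofPath k r = ofPath k p * (ofPath k q * ofPath k r)
    rw [ofPath_mul_ofPath, ofPath_mul_ofPath, pathMul_assoc]
  exact LinearMap.congr_fun (LinearMap.congr_fun (LinearMap.congr_fun hLR f) g) h

instance : NonUnitalRing (PathAlgebra k Q) where
  left_distrib f g h := by simp [mul_def]
  right_distrib f g h := by simp [mul_def]
  zero_mul := zero_mul'
  mul_zero := mul_zero'
  mul_assoc := mul_assoc'

instance : IsScalarTower k (PathAlgebra k Q) (PathAlgebra k Q) where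
  smul_assoc c f g := by simp [smul_eq_mul, mul_def]

instance : SMulCommClass k (PathAlgebra k Q) (PathAlgebra k Q) where
  smul_comm c f g := by simp [smul_eq_mul, mul_def]

variable (k Q) in
/-- `kQ_n`, spanned by the paths of length `n`. -/
def degreePart (n : ℕ) : Submodule k (PathAlgebra k Q) :=
  Submodule.span k {f | ∃ p : QPath Q, p.length = n ∧ f = ofPath k p}

variable (k) in
/-- `kQ_n(x, y)`, spanned by the paths of length `n` from `x` to `y`. -/
def degreePartFromTo (n : ℕ) (x y : Q) : Submodule k (PathAlgebra k Q) :=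
  Submodule.span k
    {f | ∃ p : QPath Q, p.source = x ∧ p.target = y ∧ p.length = n ∧ f = ofPath k p}

/-- The map `γ ↦ γᵒ` from `kQ` to the path algebra of the opposite quiver. -/
def op : PathAlgebra k Q →ₗ[k] PathAlgebra k Qᵒᵖ :=
  toFinsupp.symm.toLinearMap ∘ₗ Finsupp.lmapDomain k k QPath.op ∘ₗ toFinsupp.toLinearMap

/-- The value `ρ^*(γ) = ∑_p ρ_p γ_p`, where `ρ^*` is the linear form corresponding to `ρ` under the
dual basis of the basis of paths. -/
def starPairing (ρ γ : PathAlgebra k Q) : k :=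
  (toFinsupp ρ).sum fun p c => c * toFinsupp γ p

/-- A left local unit for a given element of `kQ`. -/
theorem exists_left_unit (f : PathAlgebra k Q) : ∃ e : PathAlgebra k Q, e * f = f := by
  let s : Finset Q := (toFinsupp f).support.image QPath.target
  let e : PathAlgebra k Q := ∑ x ∈ s, ofPath k (QPath.trivial x)
  have he : ∀ p ∈ (toFinsupp f).support, e * ofPath k p = ofPath k p := by
    intro p hp
    have hps : p.target ∈ s := Finset.mem_image_of_mem _ hp
    have h1 : ∀ x, ofPath k (QPath.trivial x) * ofPath k p =
        if p.target = x then ofPath k p else 0 := by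
      intro x
      rw [ofPath_mul_ofPath]
      obtain ⟨p₁, p₂, p⟩ := p
      by_cases h : p₂ = x
      · subst h
        simp [pathMul, QPath.trivial, QPath.comp, QPath.target, QPath.source]
      · simp [pathMul, QPath.trivial, QPath.target, QPath.source, h]
    simp only [e, Finset.sum_mul, h1]
    simp [hps]
  have hf : f = ∑ p ∈ (toFinsupp f).support, toFinsupp f p • ofPath k p := by
    apply (toFinsupp (k := k) (Q := Q)).injective
    rw [map_sum]
    conv_lhs => rw [← Finsupp.sum_single (toFinsupp f)]
    refine Finset.sum_congr rfl fun p _ => ?_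
    simp [ofPath]
  refine ⟨e, ?_⟩
  conv_lhs => rw [hf]
  conv_rhs => rw [hf]
  rw [Finset.mul_sum]
  refine Finset.sum_congr rfl fun p hp => ?_
  rw [mul_smul_comm, he p hp]

/-- Every two-sided ideal of `kQ` is a subspace. -/
theorem smul_mem (R : TwoSidedIdeal (PathAlgebra k Q)) (c : k) {f : PathAlgebra k Q}
    (hf : f ∈ R) : c • f ∈ R := by
  obtain ⟨e, he⟩ := exists_left_unit f
  rw [← he, ← smul_mul_assoc]
  exact R.mul_mem_left _ _ hf

end PathAlgebra

open PathAlgebra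

variable {k : Type w} [Field k] {Q : Type u} [Quiver.{v} Q]

/-- An ideal of `kQ` is quadratic if it is generated by a set of quadratic relations, that is, of
elements of the spaces `kQ_2(x, y)`. -/
def IsQuadratic (R : TwoSidedIdeal (PathAlgebra k Q)) : Prop :=
  ∃ S : Set (PathAlgebra k Q),
    (∀ ρ ∈ S, ∃ x y : Q, ρ ∈ degreePartFromTo k 2 x y) ∧ R = TwoSidedIdeal.span S

/-- The ideal `R^!` of the path algebra of the opposite quiver: it is generated by the elements
`ρᵒ`, where `ρ ∈ kQ_2(x, y)` is such that `ρ^*` vanishes on `R_2(x, y) = R ∩ kQ_2(x, y)`. -/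
def quadraticDual (R : TwoSidedIdeal (PathAlgebra k Q)) : TwoSidedIdeal (PathAlgebra k Qᵒᵖ) :=
  TwoSidedIdeal.span
    {σ | ∃ x y : Q, ∃ ρ ∈ degreePartFromTo k 2 x y,
      (∀ γ ∈ R, γ ∈ degreePartFromTo k 2 x y → starPairing ρ γ = 0) ∧ σ = PathAlgebra.op ρ}

/-! ### The algebra `Λ = kQ/R` -/

/-- The algebra `Λ = kQ/R`. -/
def QuotientAlgebra (R : TwoSidedIdeal (PathAlgebra k Q)) : Type (max u v w) :=
  R.ringCon.Quotient

namespace QuotientAlgebra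

variable (R : TwoSidedIdeal (PathAlgebra k Q))

instance : NonUnitalRing (QuotientAlgebra R) := inferInstanceAs (NonUnitalRing R.ringCon.Quotient)

/-- The class in `Λ` of an element of `kQ`. -/
def mk : PathAlgebra k Q → QuotientAlgebra R := fun f => (f : R.ringCon.Quotient)

theorem mk_surjective : Function.Surjective (mk R) := Quotient.mk''_surjective

theorem mk_eq_mk {f g : PathAlgebra k Q} : mk R f = mk R g ↔ f - g ∈ R :=
  (RingCon.eq R.ringCon).trans (R.rel_iff f g)

theorem mk_add (f g : PathAlgebra k Q) : mk R (f + g) = mk R f + mk R g := rfl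

theorem mk_mul (f g : PathAlgebra k Q) : mk R (f * g) = mk R f * mk R g := rfl

theorem mk_zero : mk R 0 = 0 := rfl

instance : SMul k (QuotientAlgebra R) where
  smul c := Quotient.map' (fun f => c • f) fun f g h => by
    have h2 : f - g ∈ R := (R.rel_iff f g).1 h
    refine (R.rel_iff _ _).2 ?_
    rw [← smul_sub]
    exact smul_mem R c h2

theorem mk_smul (c : k) (f : PathAlgebra k Q) : mk R (c • f) = c • mk R f := rfl

instance : Module k (QuotientAlgebra R) where
  one_smul a := by
    obtain ⟨f, rfl⟩ := mk_surjective R a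
    rw [← mk_smul, one_smul]
  mul_smul c d a := by
    obtain ⟨f, rfl⟩ := mk_surjective R a
    rw [← mk_smul, ← mk_smul, ← mk_smul, mul_smul]
  smul_zero c := by rw [← mk_zero, ← mk_smul, smul_zero]
  smul_add c a b := by
    obtain ⟨f, rfl⟩ := mk_surjective R a
    obtain ⟨g, rfl⟩ := mk_surjective R b
    simp only [← mk_smul, ← mk_add, smul_add]
  add_smul c d a := by
    obtain ⟨f, rfl⟩ := mk_surjective R a
    simp only [← mk_smul, ← mk_add, add_smul]
  zero_smul a := by
    obtain ⟨f, rfl⟩ := mk_surjective R a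
    rw [← mk_smul, zero_smul, mk_zero]

instance : IsScalarTower k (QuotientAlgebra R) (QuotientAlgebra R) where
  smul_assoc c a b := by
    obtain ⟨f, rfl⟩ := mk_surjective R a
    obtain ⟨g, rfl⟩ := mk_surjective R b
    simp only [smul_eq_mul, ← mk_smul, ← mk_mul, smul_mul_assoc]

instance : SMulCommClass k (QuotientAlgebra R) (QuotientAlgebra R) where
  smul_comm c a b := by
    obtain ⟨f, rfl⟩ := mk_surjective R a
    obtain ⟨g, rfl⟩ := mk_surjective R b
    simp only [smul_eq_mul, ← mk_smul, ← mk_mul, mul_smul_comm]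

/-- The idempotent `e_x` of `Λ`. -/
def idem (x : Q) : QuotientAlgebra R := mk R (ofPath k (QPath.trivial x))

/-- The ideal `J` of `Λ` generated by the classes of the arrows. -/
def arrowIdeal : TwoSidedIdeal (QuotientAlgebra R) :=
  TwoSidedIdeal.span {a | ∃ (x y : Q) (α : x ⟶ y), a = mk R (ofPath k (QPath.ofArrow α))}

/-- The membership of an element of `Λ` in the subspace `Λ_n`, spanned by the classes of the paths
of length `n`. -/
def HasDegree (n : ℕ) (a : QuotientAlgebra R) : Prop :=
  ∃ f ∈ degreePart k Q n, a = mk R f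

end QuotientAlgebra

/-! ### Modules over `Λ` -/

/-- The algebra `k ⊕ Λ`. Since `Λ` need not have a unit, left `Λ`-modules over `k` are taken to be
modules over this algebra with unit; the submodules and the linear maps are the same for both
algebras. All modules that occur below are unitary, that is, sums of the subspaces `e_x M`. -/
abbrev Unital (R : TwoSidedIdeal (PathAlgebra k Q)) : Type (max u v w) :=
  Unitization k (QuotientAlgebra R)

namespace QuotientAlgebra

variable (R : TwoSidedIdeal (PathAlgebra k Q))

/-- `Λ` as a left module over itself. -/
instance : Module (Unital R) (QuotientAlgebra R) where
  smul r a := r.fst • a + r.snd * a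
  one_smul a := by
    change (1 : Unital R).fst • a + (1 : Unital R).snd * a = a
    simp
  mul_smul r s a := by
    change (r * s).fst • a + (r * s).snd * a =
      r.fst • (s.fst • a + s.snd * a) + r.snd * (s.fst • a + s.snd * a)
    simp only [Unitization.fst_mul, Unitization.snd_mul, add_mul, smul_add, mul_add, mul_smul,
      smul_mul_assoc, mul_smul_comm, mul_assoc]
    abel
  smul_zero r := by
    change r.fst • (0 : QuotientAlgebra R) + r.snd * 0 = 0
    simp
  smul_add r a b := by
    change r.fst • (a + b) + r.snd * (a + b) =
      (r.fst • a + r.snd * a) + (r.fst • b + r.snd * b)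
    rw [smul_add, mul_add]
    abel
  add_smul r s a := by
    change (r + s).fst • a + (r + s).snd * a =
      (r.fst • a + r.snd * a) + (s.fst • a + s.snd * a)
    rw [Unitization.fst_add, Unitization.snd_add, add_smul, add_mul]
    abel
  zero_smul a := by
    change (0 : Unital R).fst • a + (0 : Unital R).snd * a = 0
    simp

theorem unital_smul_def (r : Unital R) (a : QuotientAlgebra R) :
    r • a = r.fst • a + r.snd * a := rfl

instance : IsScalarTower k (Unital R) (QuotientAlgebra R) where
  smul_assoc c r a := by
    simp only [unital_smul_def, Unitization.fst_smul, Unitization.snd_smul, smul_add, smul_assoc,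
      smul_mul_assoc]

end QuotientAlgebra

open QuotientAlgebra

variable (R : TwoSidedIdeal (PathAlgebra k Q))

/-- The projective left module `P_x = Λ e_x`. -/
def projModule (x : Q) : Submodule (Unital R) (QuotientAlgebra R) where
  carrier := {a | ∃ b : QuotientAlgebra R, a = b * idem R x}
  add_mem' := by
    rintro _ _ ⟨b, rfl⟩ ⟨c, rfl⟩
    exact ⟨b + c, (add_mul _ _ _).symm⟩
  zero_mem' := ⟨0, (zero_mul _).symm⟩
  smul_mem' := by
    rintro r _ ⟨b, rfl⟩
    exact ⟨r.fst • b + r.snd * b, by rw [unital_smul_def, add_mul, smul_mul_assoc, mul_assoc]⟩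

/-- The finite direct sum `P_{x_1} ⊕ ⋯ ⊕ P_{x_n}`. Up to isomorphism, these are the objects of
`proj Λ`. -/
abbrev ProjSum {n : ℕ} (x : Fin n → Q) : Type (max u v w) := ∀ i, projModule R (x i)

/-- The submodule `JM` of a module `M`. -/
def radical (M : Type*) [AddCommGroup M] [Module (Unital R) M] : Submodule (Unital R) M :=
  Submodule.span (Unital R)
    {m | ∃ j ∈ arrowIdeal R, ∃ m' : M, m = (Unitization.inr j : Unital R) • m'}

/-- The simple module `S_a = Λ e_a / J e_a`. -/
abbrev simpleModule (a : Q) : Type (max u v w) :=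
  projModule R a ⧸ radical R (projModule R a)

/-- The homogeneous elements of degree `d` of `P_{x_1} ⊕ ⋯ ⊕ P_{x_n}`, where each summand `Λ e_x`
is graded by the subspaces `Λ_d e_x` and so is generated in degree zero. -/
def IsHomogeneousElement {n : ℕ} {x : Fin n → Q} (d : ℕ) (m : ProjSum R x) : Prop :=
  ∀ i, HasDegree R d (m i : QuotientAlgebra R)

/-- A linear projective resolution over `proj Λ` of a `Λ`-module `M`: an exact sequence
`⋯ → P^{-2} → P^{-1} → P^0 → M → 0`, whose modules `P^{-n}` are finite direct sums of modules
`P_x`, such that every map `d^{-n}`, including `d^0 : P^0 → M`, co-restricts to a projective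
`J`-cover of its image, that is, the kernel of `d^{-n}` is contained in `J P^{-n}`, and every
`d^{-n}` with `n > 0` is homogeneous of degree one. -/
structure LinearProjectiveResolution (M : Type*) [AddCommGroup M] [Module (Unital R) M] where
  /-- The number of summands of `P^{-n}`. -/
  rank : ℕ → ℕ
  /-- The vertices `x` of the summands `P_x` of `P^{-n}`. -/
  vertex : ∀ n, Fin (rank n) → Q
  /-- The map `d^0 : P^0 → M`. -/
  aug : ProjSum R (vertex 0) →ₗ[Unital R] M
  /-- The map `d^{-(n+1)} : P^{-(n+1)} → P^{-n}`. -/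
  diff : ∀ n, ProjSum R (vertex (n + 1)) →ₗ[Unital R] ProjSum R (vertex n)
  aug_surjective : Function.Surjective aug
  exact_zero : Function.Exact (diff 0) aug
  exact_succ : ∀ n, Function.Exact (diff (n + 1)) (diff n)
  ker_aug_le : LinearMap.ker aug ≤ radical R (ProjSum R (vertex 0))
  ker_diff_le : ∀ n, LinearMap.ker (diff n) ≤ radical R (ProjSum R (vertex (n + 1)))
  homogeneous : ∀ (n d : ℕ) (m : ProjSum R (vertex (n + 1))),
    IsHomogeneousElement R d m → IsHomogeneousElement R (d + 1) (diff n m)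

/-- `Λ = kQ/R` is Koszul if each of the simple modules `S_a`, with `a` a vertex, has a linear
projective resolution over `proj Λ`. -/
def IsKoszul : Prop :=
  ∀ a : Q, Nonempty (LinearProjectiveResolution R (simpleModule R a))

end

end BoundQuiver

/-! Koszulity is turned into a statement about subspaces of kQ that is visibly self-dual. Let K_m be
the space of elements of kQ_m that satisfy the quadratic relations at every pair of consecutive
arrows. For fixed n put A_i = kQ_i K_{n-i} (`koszulPart R i n`) and B_i = R_i kQ_{n-i} (`idealPart R
i n`). The degree n strand of the Koszul complex has terms Λ_i ⊗ K_{n-i} = A_i / (A_i ∩ B_i), the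
tensor product being over the span of the vertices, and its differential is induced by the inclusion
of A_i in A_{i+1}. Exactness at the term of index i+1 therefore reads A_{i+1} ∩ B_{i+2} ⊆ B_{i+1} +
A_i. This is `KoszulExact`. The two ends of the strand need no hypothesis: K_1 = kQ_1 takes care of
the terms with K_0, and R_1 = 0 of the terms with Λ_0.

Duality: let paths be orthonormal, and reverse them. Then B_l is orthogonal to A'_m and A_m to B'_l
whenever l + m = n, where the primes refer to R^! (`PathDuality.IsDual.pair_idealPart`). Taking
orthogonals exchanges sums and intersections, so the inclusion for R at i becomes the same inclusion
for R^! at j with i + j = n - 2 (`PathDuality.IsDual.koszulExact`). Local finiteness enters through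
`mem_of_orthogonal`: the paths of given length from a given vertex are finite in number, so
subspaces stable under the vertices equal their double orthogonals, even if Q has infinitely many
vertices.

Koszulity is equivalent to these inclusions (`isKoszul_iff_koszulExact`). In a linear resolution of
S_a the differentials are matrices of linear elements; minimality and exactness force the successive
products of the matrices to be bases of the spaces K_n e_a (`IsKoszulBasis.succ`), so the resolution
is the Koszul complex. Conversely, bases of the K_n e_a define that complex, and the inclusions make
it exact. Both directions rest on `IsKoszulBasis.mem_of_sum_mem`: against a basis of K_j e_a, a sum
∑ f_s φ_s determines the coefficients f_s modulo R. -/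

namespace BoundQuiver

noncomputable section

open Classical PathAlgebra

/-! ### Factorization of paths -/

namespace QPath

variable {Q : Type u} [Quiver.{v} Q]

theorem length_comp (p q : QPath Q) (h : q.target = p.source) :
    (p.comp q h).length = p.length + q.length := by
  obtain ⟨p₁, p₂, p⟩ := p
  obtain ⟨q₁, q₂, q⟩ := q
  obtain rfl : q₂ = p₁ := h
  change (q.comp p).length = p.length + q.length
  rw [Quiver.Path.length_comp, add_comm]

theorem length_trivial (x : Q) : (trivial x).length = 0 := rfl

theorem eq_trivial_of_length_eq_zero {p : QPath Q} (h : p.length = 0) :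
    p = trivial p.source := by
  obtain ⟨x, y, p⟩ := p
  obtain rfl := Quiver.Path.eq_of_length_zero p h
  obtain rfl := Quiver.Path.eq_nil_of_length_zero p h
  rfl

/-- Equal lengths of the second factors put the cut at the same place, and arrows can be removed
from the end one at a time. The intermediate vertices are not known to agree beforehand, hence the
sigma types. -/
theorem comp_path_inj {a b b' c : Q} {p : Quiver.Path b c} {p' : Quiver.Path b' c}
    {q : Quiver.Path a b} {q' : Quiver.Path a b'} (h : q.comp p = q'.comp p')
    (hl : p.length = p'.length) : (⟨b, p⟩ : Σ b, Quiver.Path b c) = ⟨b', p'⟩ ∧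
      (⟨b, q⟩ : Σ b, Quiver.Path a b) = ⟨b', q'⟩ := by
  induction p with
  | nil =>
    cases p' with
    | nil => simpa using h
    | cons => simp at hl
  | cons p α ih =>
    cases p' with
    | nil => simp at hl
    | cons p' α' =>
      simp only [Quiver.Path.comp_cons, Quiver.Path.cons.injEq] at h
      obtain ⟨rfl, h, h'⟩ := h
      obtain rfl := eq_of_heq h'
      obtain ⟨h1, h2⟩ := ih (eq_of_heq h) (by simpa using hl)
      refine ⟨?_, h2⟩
      cases h1
      rfl

theorem comp_inj {p p' q q' : QPath Q} {h : q.target = p.source} {h' : q'.target = p'.source}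
    (hc : p.comp q h = p'.comp q' h') (hl : q.length = q'.length) : p = p' ∧ q = q' := by
  have hl' : p.length = p'.length := by
    have := congrArg length hc
    rw [length_comp, length_comp] at this
    omega
  obtain ⟨p₁, p₂, p⟩ := p
  obtain ⟨q₁, q₂, q⟩ := q
  obtain ⟨p₁', p₂', p'⟩ := p'
  obtain ⟨q₁', q₂', q'⟩ := q'
  obtain rfl : q₂ = p₁ := h
  obtain rfl : q₂' = p₁' := h'
  simp only [comp, Sigma.mk.injEq] at hc
  obtain ⟨rfl, hc⟩ := hc
  have hc := eq_of_heq hc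
  simp only [Sigma.mk.injEq] at hc
  obtain ⟨rfl, hc⟩ := hc
  obtain ⟨h1, h2⟩ := comp_path_inj (eq_of_heq hc) hl'
  cases h1
  simp only [Sigma.mk.injEq, heq_eq_eq, true_and] at h2
  subst h2
  exact ⟨rfl, rfl⟩

theorem exists_comp_eq (r : QPath Q) {i j : ℕ} (hr : r.length = i + j) :
    ∃ p q : QPath Q, ∃ h : q.target = p.source, p.comp q h = r ∧ p.length = i ∧ q.length = j := by
  obtain ⟨x, y, r⟩ := r
  have hr' : r.length = i + j := hr
  obtain ⟨v, q, p, rfl, hq⟩ := r.exists_eq_comp_of_le_length (n := j) (by omega)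
  refine ⟨⟨v, y, p⟩, ⟨x, v, q⟩, rfl, rfl, ?_, hq⟩
  simp only [Quiver.Path.length_comp] at hr'
  simp only [length]
  omega

end QPath

/-! ### The pairing on kQ and division by elements -/

namespace PathAlgebra

variable {k : Type w} [Field k] {Q : Type u} [Quiver.{v} Q]

theorem eq_sum_coeff (f : PathAlgebra k Q) :
    f = ∑ p ∈ (toFinsupp f).support, toFinsupp f p • ofPath k p := by
  apply (toFinsupp (k := k) (Q := Q)).injective
  rw [map_sum]
  conv_lhs => rw [← Finsupp.sum_single (toFinsupp f)]
  refine Finset.sum_congr rfl fun p _ => ?_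
  simp [ofPath]

theorem mem_of_paths {M : Submodule k (PathAlgebra k Q)} (f : PathAlgebra k Q)
    (h : ∀ p, toFinsupp f p ≠ 0 → ofPath k p ∈ M) : f ∈ M := by
  rw [eq_sum_coeff f]
  exact M.sum_mem fun p hp => M.smul_mem _ (h p (by simpa using hp))

/-- The pairing in which the paths are an orthonormal basis. -/
def pair : PathAlgebra k Q →ₗ[k] PathAlgebra k Q →ₗ[k] k :=
  (Finsupp.linearCombination k fun p : QPath Q =>
    (Finsupp.lapply p : (QPath Q →₀ k) →ₗ[k] k) ∘ₗ toFinsupp.toLinearMap) ∘ₗ toFinsupp.toLinearMap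

theorem starPairing_eq_pair (f g : PathAlgebra k Q) : starPairing f g = pair f g := by
  simp [starPairing, pair, Finsupp.linearCombination_apply, Finsupp.sum, LinearMap.sum_apply]

theorem pair_ofPath_left (p : QPath Q) (g : PathAlgebra k Q) :
    pair (ofPath k p) g = toFinsupp g p := by
  simp [pair, ofPath]

theorem pair_ofPath_ofPath (p q : QPath Q) :
    pair (ofPath k p) (ofPath k q) = if p = q then 1 else 0 := by
  rw [pair_ofPath_left]
  simp [ofPath, Finsupp.single_apply, eq_comm]

theorem pair_comm (f g : PathAlgebra k Q) : pair f g = pair g f := by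
  have : (pair : PathAlgebra k Q →ₗ[k] PathAlgebra k Q →ₗ[k] k) = pair.flip := by
    refine linearMap_ext fun p => linearMap_ext fun q => ?_
    simp only [LinearMap.flip_apply, pair_ofPath_ofPath, eq_comm]
  exact LinearMap.congr_fun (LinearMap.congr_fun this f) g

theorem pair_ofPath_right (p : QPath Q) (g : PathAlgebra k Q) :
    pair g (ofPath k p) = toFinsupp g p := by
  rw [pair_comm, pair_ofPath_left]

theorem ext_pair {f g : PathAlgebra k Q} (h : ∀ p, pair f (ofPath k p) = pair g (ofPath k p)) :
    f = g := by
  apply (toFinsupp (k := k) (Q := Q)).injective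
  ext p
  simpa only [pair_ofPath_right] using h p

/-- The path `p` with `p q = r`, or zero if there is none. -/
def rdivPath (q r : QPath Q) : PathAlgebra k Q :=
  if h : ∃ p : QPath Q, ∃ hc : q.target = p.source, p.comp q hc = r then ofPath k h.choose else 0

/-- The path `q` with `p q = r`, or zero if there is none. -/
def ldivPath (p r : QPath Q) : PathAlgebra k Q :=
  if h : ∃ q : QPath Q, ∃ hc : q.target = p.source, p.comp q hc = r then ofPath k h.choose else 0

/-- The adjoint of right multiplication by `v`, for the pairing `pair`. -/
def rdiv : PathAlgebra k Q →ₗ[k] PathAlgebra k Q →ₗ[k] PathAlgebra k Q :=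
  (Finsupp.linearCombination k fun q : QPath Q =>
    (Finsupp.linearCombination k fun r : QPath Q => (rdivPath q r : PathAlgebra k Q)) ∘ₗ
      toFinsupp.toLinearMap) ∘ₗ toFinsupp.toLinearMap

/-- The adjoint of left multiplication by `v`, for the pairing `pair`. -/
def ldiv : PathAlgebra k Q →ₗ[k] PathAlgebra k Q →ₗ[k] PathAlgebra k Q :=
  (Finsupp.linearCombination k fun q : QPath Q =>
    (Finsupp.linearCombination k fun r : QPath Q => (ldivPath q r : PathAlgebra k Q)) ∘ₗ
      toFinsupp.toLinearMap) ∘ₗ toFinsupp.toLinearMap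

theorem pair_pathMul (r p q : QPath Q) : pair (ofPath k r) (pathMul p q) =
    if ∃ hc : q.target = p.source, p.comp q hc = r then 1 else 0 := by
  by_cases h : q.target = p.source
  · simp only [pathMul, h, dite_true, pair_ofPath_ofPath, exists_true_left, eq_comm]
  · simp [pathMul, h]

/-- By trilinearity this is a statement about three paths. Right cancellation of paths makes the
choice in `rdivPath` harmless. -/
theorem pair_rdiv (v f u : PathAlgebra k Q) : pair (rdiv v f) u = pair f (u * v) := by
  let L : PathAlgebra k Q →ₗ[k] PathAlgebra k Q →ₗ[k] PathAlgebra k Q →ₗ[k] k :=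
    rdiv.compr₂ pair
  let M : PathAlgebra k Q →ₗ[k] PathAlgebra k Q →ₗ[k] PathAlgebra k Q →ₗ[k] k :=
    (((LinearMap.llcomp k _ _ _).flip ∘ₗ mulBilin.flip).flip ∘ₗ pair).flip
  have hLM : L = M := by
    refine linearMap_ext fun q => linearMap_ext fun r => linearMap_ext fun p => ?_
    change pair (rdiv (ofPath k q) (ofPath k r)) (ofPath k p) =
      pair (ofPath k r) (ofPath k p * ofPath k q)
    rw [ofPath_mul_ofPath, pair_pathMul]
    have h1 : (rdiv (ofPath k q) (ofPath k r) : PathAlgebra k Q) = rdivPath q r := by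
      simp [rdiv, ofPath]
    rw [h1, rdivPath]
    by_cases h : ∃ p : QPath Q, ∃ hc : q.target = p.source, p.comp q hc = r
    · rw [dif_pos h, pair_ofPath_ofPath]
      obtain ⟨hc, hs⟩ := h.choose_spec
      congr 1
      refine propext ⟨fun h2 => h2 ▸ h.choose_spec, fun ⟨hc', hs'⟩ => ?_⟩
      exact (QPath.comp_inj (hs.trans hs'.symm) rfl).1
    · rw [dif_neg h, if_neg fun h2 => h ⟨p, h2⟩]
      simp
  exact LinearMap.congr_fun (LinearMap.congr_fun (LinearMap.congr_fun hLM v) f) u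

theorem pair_ldiv (v f u : PathAlgebra k Q) : pair (ldiv v f) u = pair f (v * u) := by
  let L : PathAlgebra k Q →ₗ[k] PathAlgebra k Q →ₗ[k] PathAlgebra k Q →ₗ[k] k :=
    ldiv.compr₂ pair
  let M : PathAlgebra k Q →ₗ[k] PathAlgebra k Q →ₗ[k] PathAlgebra k Q →ₗ[k] k :=
    (((LinearMap.llcomp k _ _ _).flip ∘ₗ mulBilin).flip ∘ₗ pair).flip
  have hLM : L = M := by
    refine linearMap_ext fun p => linearMap_ext fun r => linearMap_ext fun q => ?_
    change pair (ldiv (ofPath k p) (ofPath k r)) (ofPath k q) =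
      pair (ofPath k r) (ofPath k p * ofPath k q)
    rw [ofPath_mul_ofPath, pair_pathMul]
    have h1 : (ldiv (ofPath k p) (ofPath k r) : PathAlgebra k Q) = ldivPath p r := by
      simp [ldiv, ofPath]
    rw [h1, ldivPath]
    by_cases h : ∃ q : QPath Q, ∃ hc : q.target = p.source, p.comp q hc = r
    · rw [dif_pos h, pair_ofPath_ofPath]
      obtain ⟨hc, hs⟩ := h.choose_spec
      congr 1
      refine propext ⟨fun h2 => h2 ▸ h.choose_spec, fun ⟨hc', hs'⟩ => ?_⟩
      refine (QPath.comp_inj (hs.trans hs'.symm) ?_).2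
      have := congrArg QPath.length (hs.trans hs'.symm)
      rw [QPath.length_comp, QPath.length_comp] at this
      omega
    · rw [dif_neg h, if_neg fun h2 => h ⟨q, h2⟩]
      simp
  exact LinearMap.congr_fun (LinearMap.congr_fun (LinearMap.congr_fun hLM v) f) u

theorem ext_pair' {f g : PathAlgebra k Q} (h : ∀ u, pair f u = pair g u) : f = g :=
  ext_pair fun _ => h _

/-- The rules for iterated division are the associative law, read through the adjunction with
multiplication. -/
theorem rdiv_rdiv (v w f : PathAlgebra k Q) : rdiv v (rdiv w f) = rdiv (v * w) f :=
  ext_pair' fun u => by simp only [pair_rdiv, mul_assoc]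

theorem ldiv_ldiv (v w f : PathAlgebra k Q) : ldiv v (ldiv w f) = ldiv (w * v) f :=
  ext_pair' fun u => by simp only [pair_ldiv, mul_assoc]

theorem ldiv_rdiv (v w f : PathAlgebra k Q) : ldiv v (rdiv w f) = rdiv w (ldiv v f) :=
  ext_pair' fun u => by simp only [pair_ldiv, pair_rdiv, mul_assoc]

/-! ### Vertices -/

variable (k) in
/-- The idempotent of `kQ` at a vertex. -/
def vtx (x : Q) : PathAlgebra k Q := ofPath k (QPath.trivial x)

theorem ofPath_mul_vtx (p : QPath Q) (x : Q) :
    ofPath k p * vtx k x = if p.source = x then ofPath k p else 0 := by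
  obtain ⟨p₁, p₂, p⟩ := p
  rw [vtx, ofPath_mul_ofPath]
  by_cases h : p₁ = x
  · subst h
    simp [pathMul, QPath.trivial, QPath.comp, QPath.target, QPath.source]
  · have h' : x ≠ p₁ := fun e => h e.symm
    simp [pathMul, QPath.trivial, QPath.target, QPath.source, h, h']

theorem vtx_mul_ofPath (p : QPath Q) (x : Q) :
    vtx k x * ofPath k p = if p.target = x then ofPath k p else 0 := by
  obtain ⟨p₁, p₂, p⟩ := p
  rw [vtx, ofPath_mul_ofPath]
  by_cases h : p₂ = x
  · subst h
    simp [pathMul, QPath.trivial, QPath.comp, QPath.target, QPath.source]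
  · simp [pathMul, QPath.trivial, QPath.target, QPath.source, h]

theorem vtx_mul_vtx (x y : Q) : vtx k x * vtx k y = if x = y then vtx k x else 0 :=
  ofPath_mul_vtx _ _

theorem vtx_mul_self (x : Q) : vtx k x * vtx k x = vtx k x := by simp [vtx_mul_vtx]

/-- Multiplication by a vertex is an orthogonal projection onto a span of paths, hence its own
adjoint. -/
theorem rdiv_vtx (x : Q) (f : PathAlgebra k Q) : rdiv (vtx k x) f = f * vtx k x := by
  have : (rdiv (vtx k x) : PathAlgebra k Q →ₗ[k] _) = mulBilin.flip (vtx k x) := by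
    refine linearMap_ext fun p => ext_pair fun q => ?_
    rw [pair_rdiv]
    change _ = pair (ofPath k p * vtx k x) _
    simp only [ofPath_mul_vtx]
    by_cases h : p = q
    · subst h; split_ifs <;> simp
    · split_ifs <;> simp [pair_ofPath_ofPath, h]
  exact LinearMap.congr_fun this f

theorem ldiv_vtx (x : Q) (f : PathAlgebra k Q) : ldiv (vtx k x) f = vtx k x * f := by
  have : (ldiv (vtx k x) : PathAlgebra k Q →ₗ[k] _) = mulBilin (vtx k x) := by
    refine linearMap_ext fun p => ext_pair fun q => ?_
    rw [pair_ldiv]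
    change _ = pair (vtx k x * ofPath k p) _
    simp only [vtx_mul_ofPath]
    by_cases h : p = q
    · subst h; split_ifs <;> simp
    · split_ifs <;> simp [pair_ofPath_ofPath, h]
  exact LinearMap.congr_fun this f

theorem pair_mul_vtx (f g : PathAlgebra k Q) (x : Q) :
    pair (f * vtx k x) g = pair f (g * vtx k x) := by rw [← rdiv_vtx, pair_rdiv]

theorem pair_vtx_mul (f g : PathAlgebra k Q) (x : Q) :
    pair (vtx k x * f) g = pair f (vtx k x * g) := by rw [← ldiv_vtx, pair_ldiv]

/-! ### Degrees -/

/-- The projection of `kQ` onto `kQ_n`. -/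
def proj (n : ℕ) : PathAlgebra k Q →ₗ[k] PathAlgebra k Q :=
  (Finsupp.linearCombination k fun p : QPath Q =>
    if p.length = n then ofPath k p else 0) ∘ₗ toFinsupp.toLinearMap

theorem proj_ofPath (n : ℕ) (p : QPath Q) :
    proj n (ofPath k p) = if p.length = n then ofPath k p else 0 := by
  simp [proj, ofPath]

theorem ofPath_mem_degreePart {p : QPath Q} {n : ℕ} (h : p.length = n) :
    ofPath k p ∈ degreePart k Q n := Submodule.subset_span ⟨p, h, rfl⟩

theorem vtx_mem (x : Q) : vtx k x ∈ degreePart k Q 0 := ofPath_mem_degreePart rfl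

theorem proj_eq_self {n : ℕ} {f : PathAlgebra k Q} (hf : f ∈ degreePart k Q n) :
    proj n f = f := by
  induction hf using Submodule.span_induction with
  | mem f hf => obtain ⟨p, hp, rfl⟩ := hf; simp [proj_ofPath, hp]
  | zero => simp
  | add f g _ _ hf hg => simp [hf, hg]
  | smul c f _ hf => simp [hf]

theorem proj_eq_zero {m n : ℕ} {f : PathAlgebra k Q} (hf : f ∈ degreePart k Q m) (h : m ≠ n) :
    proj n f = 0 := by
  induction hf using Submodule.span_induction with
  | mem f hf => obtain ⟨p, hp, rfl⟩ := hf; simp [proj_ofPath, hp, h]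
  | zero => simp
  | add f g _ _ hf hg => simp [hf, hg]
  | smul c f _ hf => simp [hf]

theorem proj_mem (n : ℕ) (f : PathAlgebra k Q) : proj n f ∈ degreePart k Q n := by
  suffices f ∈ (degreePart k Q n).comap (proj n) from this
  refine mem_of_paths f fun p _ => ?_
  rw [Submodule.mem_comap, proj_ofPath]
  split_ifs with h
  · exact ofPath_mem_degreePart h
  · exact Submodule.zero_mem _

theorem pair_proj (n : ℕ) (f g : PathAlgebra k Q) : pair (proj n f) g = pair f (proj n g) := by
  have : (pair.comp (proj n) : PathAlgebra k Q →ₗ[k] PathAlgebra k Q →ₗ[k] k) =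
      pair.compl₂ (proj n) := by
    refine linearMap_ext fun p => linearMap_ext fun q => ?_
    simp only [LinearMap.comp_apply, LinearMap.compl₂_apply, proj_ofPath]
    by_cases h : p = q
    · subst h; split_ifs <;> simp
    · split_ifs <;> simp [pair_ofPath_ofPath, h]
  exact LinearMap.congr_fun (LinearMap.congr_fun this f) g

/-- The form with all `M ≥ N` lets finitely many elements share one bound. -/
theorem exists_eq_sum_proj (f : PathAlgebra k Q) :
    ∃ N, ∀ M ≥ N, f = ∑ n ∈ Finset.range M, proj n f := by
  refine ⟨(toFinsupp f).support.sup QPath.length + 1, fun M hM => ?_⟩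
  refine ext_pair fun p => ?_
  rw [map_sum, LinearMap.sum_apply]
  simp only [pair_proj, proj_ofPath]
  by_cases hp : p ∈ (toFinsupp f).support
  · have : p.length < M := lt_of_lt_of_le (Nat.lt_succ_of_le (Finset.le_sup hp)) hM
    rw [Finset.sum_eq_single p.length]
    · simp
    · intro b _ hb; simp [hb.symm]
    · simp [this]
  · have h0 : toFinsupp f p = 0 := by simpa using hp
    rw [pair_ofPath_right, h0]
    refine (Finset.sum_eq_zero fun n _ => ?_).symm
    split_ifs
    · rw [pair_ofPath_right, h0]
    · simp

theorem mul_mem_degreePart {m n : ℕ} {f g : PathAlgebra k Q} (hf : f ∈ degreePart k Q m)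
    (hg : g ∈ degreePart k Q n) : f * g ∈ degreePart k Q (m + n) := by
  suffices h : degreePart k Q m ≤ ((degreePart k Q (m + n)).comap (mulBilin.flip g)) from h hf
  refine Submodule.span_le.2 ?_
  rintro _ ⟨p, hp, rfl⟩
  suffices h : degreePart k Q n ≤ ((degreePart k Q (m + n)).comap (mulBilin (ofPath k p))) from h hg
  refine Submodule.span_le.2 ?_
  rintro _ ⟨q, hq, rfl⟩
  change ofPath k p * ofPath k q ∈ degreePart k Q (m + n)
  rw [ofPath_mul_ofPath, pathMul]
  split_ifs with h
  · exact ofPath_mem_degreePart (by rw [QPath.length_comp, hp, hq])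
  · exact Submodule.zero_mem _

theorem mul_vtx_mem {n : ℕ} {f : PathAlgebra k Q} (hf : f ∈ degreePart k Q n) (x : Q) :
    f * vtx k x ∈ degreePart k Q n := by simpa using mul_mem_degreePart hf (vtx_mem x)

theorem vtx_mul_mem {n : ℕ} {f : PathAlgebra k Q} (hf : f ∈ degreePart k Q n) (x : Q) :
    vtx k x * f ∈ degreePart k Q n := by simpa using mul_mem_degreePart (vtx_mem x) hf

theorem mem_degreePart_iff {n : ℕ} {f : PathAlgebra k Q} :
    f ∈ degreePart k Q n ↔ ∀ p : QPath Q, p.length ≠ n → pair f (ofPath k p) = 0 := by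
  constructor
  · intro hf p hp
    rw [← proj_eq_self hf, pair_proj, proj_ofPath, if_neg hp, map_zero]
  · intro h
    suffices f = proj n f by rw [this]; exact proj_mem _ _
    refine ext_pair fun p => ?_
    rw [pair_proj, proj_ofPath]
    split_ifs with hp
    · rfl
    · rw [map_zero, h p hp]

theorem pair_eq_zero_of_degree {m n : ℕ} {f g : PathAlgebra k Q} (hf : f ∈ degreePart k Q m)
    (hg : g ∈ degreePart k Q n) (h : m ≠ n) : pair f g = 0 := by
  rw [← proj_eq_self hf, pair_proj, proj_eq_zero hg h.symm, map_zero]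

theorem rdiv_mem {m n l : ℕ} {v f : PathAlgebra k Q} (hv : v ∈ degreePart k Q m)
    (hf : f ∈ degreePart k Q n) (h : n = l + m) : rdiv v f ∈ degreePart k Q l := by
  refine mem_degreePart_iff.2 fun p hp => ?_
  rw [pair_rdiv]
  exact pair_eq_zero_of_degree hf (mul_mem_degreePart (ofPath_mem_degreePart rfl) hv) (by omega)

theorem ldiv_mem {m n l : ℕ} {v f : PathAlgebra k Q} (hv : v ∈ degreePart k Q m)
    (hf : f ∈ degreePart k Q n) (h : n = m + l) : ldiv v f ∈ degreePart k Q l := by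
  refine mem_degreePart_iff.2 fun p hp => ?_
  rw [pair_ldiv]
  exact pair_eq_zero_of_degree hf (mul_mem_degreePart hv (ofPath_mem_degreePart rfl)) (by omega)

theorem proj_mul {n j : ℕ} (f : PathAlgebra k Q) {g : PathAlgebra k Q}
    (hg : g ∈ degreePart k Q j) : proj (n + j) (f * g) = proj n f * g := by
  suffices f ∈ LinearMap.eqLocus ((proj (n + j)).comp (mulBilin.flip g))
      ((mulBilin.flip g).comp (proj n)) from this
  refine mem_of_paths f fun p _ => ?_
  rw [LinearMap.mem_eqLocus]
  change proj (n + j) (ofPath k p * g) = proj n (ofPath k p) * g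
  have h := mul_mem_degreePart (ofPath_mem_degreePart (k := k) (p := p) rfl) hg
  rw [proj_ofPath]
  split_ifs with hp
  · rw [← hp]; exact proj_eq_self h
  · rw [zero_mul]; exact proj_eq_zero h (by omega)

theorem proj_mul_of_lt {n j : ℕ} (hn : n < j) (f : PathAlgebra k Q) {g : PathAlgebra k Q}
    (hg : g ∈ degreePart k Q j) : proj n (f * g) = 0 := by
  suffices f ∈ LinearMap.ker ((proj n).comp (mulBilin.flip g)) from this
  refine mem_of_paths f fun p _ => ?_
  have h := mul_mem_degreePart (ofPath_mem_degreePart (k := k) (p := p) rfl) hg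
  exact proj_eq_zero h (by omega)

theorem proj_mul_vtx (n : ℕ) (f : PathAlgebra k Q) (x : Q) :
    proj n (f * vtx k x) = proj n f * vtx k x := proj_mul (j := 0) f (vtx_mem x)

/-! ### Unique factorization of paths -/

/-- A path has only one right factor of length `j`, so the coefficients of a product split. The
vertex at the end of `q` keeps only the part of `f` that is composable with `q`. -/
theorem pair_mul_ofPath {j : ℕ} (f : PathAlgebra k Q) {g : PathAlgebra k Q}
    (hg : g ∈ degreePart k Q j) {q : QPath Q} (hq : q.length = j) (u : PathAlgebra k Q) :
    pair (f * g) (u * ofPath k q) = pair g (ofPath k q) * pair (f * vtx k q.target) u := by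
  suffices h : degreePart k Q j ≤ LinearMap.eqLocus
      ((pair.flip (u * ofPath k q)).comp (mulBilin f))
      (pair (f * vtx k q.target) u • pair.flip (ofPath k q)) by
    have := h hg
    rw [LinearMap.mem_eqLocus] at this
    rw [mul_comm]
    exact this
  refine Submodule.span_le.2 ?_
  rintro _ ⟨r, hr, rfl⟩
  change pair (f * ofPath k r) (u * ofPath k q) =
    pair (f * vtx k q.target) u * pair (ofPath k r) (ofPath k q)
  suffices f ∈ LinearMap.eqLocus ((pair.flip (u * ofPath k q)).comp (mulBilin.flip (ofPath k r)))
      (pair (ofPath k r) (ofPath k q) • (pair.flip u).comp (mulBilin.flip (vtx k q.target))) by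
    rw [LinearMap.mem_eqLocus] at this
    rw [mul_comm]
    exact this
  refine mem_of_paths f fun s _ => ?_
  suffices u ∈ LinearMap.eqLocus ((pair (ofPath k s * ofPath k r)).comp
      (mulBilin.flip (ofPath k q)))
      (pair (ofPath k r) (ofPath k q) • (pair (ofPath k s * vtx k q.target))) from this
  refine mem_of_paths u fun t _ => ?_
  rw [LinearMap.mem_eqLocus]
  change pair (ofPath k s * ofPath k r) (ofPath k t * ofPath k q) =
    pair (ofPath k r) (ofPath k q) * pair (ofPath k s * vtx k q.target) (ofPath k t)
  rw [ofPath_mul_ofPath, ofPath_mul_ofPath, ofPath_mul_vtx, pair_ofPath_ofPath]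
  by_cases h1 : r.target = s.source
  · rw [pathMul, dif_pos h1, pair_pathMul]
    by_cases hrq : r = q
    · subst hrq
      rw [if_pos rfl, if_pos h1.symm, pair_ofPath_ofPath, one_mul]
      congr 1
      refine propext ⟨fun ⟨hc, he⟩ => (QPath.comp_inj he rfl).1.symm, ?_⟩
      rintro rfl
      exact ⟨h1, rfl⟩
    · rw [if_neg, if_neg hrq, zero_mul]
      rintro ⟨hc, he⟩
      exact hrq (QPath.comp_inj he (hq.trans hr.symm)).2.symm
  · rw [pathMul, dif_neg h1]
    by_cases hrq : r = q
    · subst hrq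
      simp [Ne.symm h1]
    · simp [hrq]

theorem pair_ofPath_mul {i : ℕ} {f : PathAlgebra k Q} (g : PathAlgebra k Q)
    (hf : f ∈ degreePart k Q i) {p : QPath Q} (hp : p.length = i) (u : PathAlgebra k Q) :
    pair (f * g) (ofPath k p * u) = pair f (ofPath k p) * pair (vtx k p.source * g) u := by
  suffices h : degreePart k Q i ≤ LinearMap.eqLocus
      ((pair.flip (ofPath k p * u)).comp (mulBilin.flip g))
      (pair (vtx k p.source * g) u • pair.flip (ofPath k p)) by
    have := h hf
    rw [LinearMap.mem_eqLocus] at this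
    rw [mul_comm]
    exact this
  refine Submodule.span_le.2 ?_
  rintro _ ⟨r, hr, rfl⟩
  change pair (ofPath k r * g) (ofPath k p * u) =
    pair (vtx k p.source * g) u * pair (ofPath k r) (ofPath k p)
  suffices g ∈ LinearMap.eqLocus ((pair.flip (ofPath k p * u)).comp (mulBilin (ofPath k r)))
      (pair (ofPath k r) (ofPath k p) • (pair.flip u).comp (mulBilin (vtx k p.source))) by
    rw [LinearMap.mem_eqLocus] at this
    rw [mul_comm]
    exact this
  refine mem_of_paths g fun s _ => ?_
  suffices u ∈ LinearMap.eqLocus ((pair (ofPath k r * ofPath k s)).comp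
      (mulBilin (ofPath k p)))
      (pair (ofPath k r) (ofPath k p) • (pair (vtx k p.source * ofPath k s))) from this
  refine mem_of_paths u fun t _ => ?_
  rw [LinearMap.mem_eqLocus]
  change pair (ofPath k r * ofPath k s) (ofPath k p * ofPath k t) =
    pair (ofPath k r) (ofPath k p) * pair (vtx k p.source * ofPath k s) (ofPath k t)
  rw [ofPath_mul_ofPath, ofPath_mul_ofPath, vtx_mul_ofPath, pair_ofPath_ofPath]
  by_cases h1 : s.target = r.source
  · rw [pathMul, dif_pos h1, pair_pathMul]
    by_cases hrq : r = p
    · subst hrq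
      rw [if_pos rfl, if_pos h1, pair_ofPath_ofPath, one_mul]
      congr 1
      refine propext ⟨fun ⟨hc, he⟩ => (QPath.comp_inj he ?_).2.symm, ?_⟩
      · have := congrArg QPath.length he
        rw [QPath.length_comp, QPath.length_comp] at this
        omega
      · rintro rfl
        exact ⟨h1, rfl⟩
    · rw [if_neg, if_neg hrq, zero_mul]
      rintro ⟨hc, he⟩
      refine hrq (QPath.comp_inj he ?_).1.symm
      have := congrArg QPath.length he
      rw [QPath.length_comp, QPath.length_comp] at this
      omega
  · rw [pathMul, dif_neg h1]
    by_cases hrq : r = p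
    · subst hrq
      simp [h1]
    · simp [hrq]

/-- Dividing by a path of the same degree as the right factor reads off a coefficient of that
factor. This is how conditions on quotients are checked on products. -/
theorem rdiv_mul {j : ℕ} (f : PathAlgebra k Q) {g : PathAlgebra k Q}
    (hg : g ∈ degreePart k Q j) {q : QPath Q} (hq : q.length = j) :
    rdiv (ofPath k q) (f * g) = pair g (ofPath k q) • (f * vtx k q.target) :=
  ext_pair' fun u => by
    rw [pair_rdiv, pair_mul_ofPath f hg hq, map_smul, LinearMap.smul_apply, smul_eq_mul]

theorem ldiv_mul {i : ℕ} {f : PathAlgebra k Q} (g : PathAlgebra k Q)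
    (hf : f ∈ degreePart k Q i) {p : QPath Q} (hp : p.length = i) :
    ldiv (ofPath k p) (f * g) = pair f (ofPath k p) • (vtx k p.source * g) :=
  ext_pair' fun u => by
    rw [pair_ldiv, pair_ofPath_mul g hf hp, map_smul, LinearMap.smul_apply, smul_eq_mul]

theorem exists_eq_sum_rdiv {i j : ℕ} {f : PathAlgebra k Q} (hf : f ∈ degreePart k Q (i + j)) :
    ∃ F : Finset (QPath Q), (∀ q ∈ F, q.length = j) ∧
      f = ∑ q ∈ F, rdiv (ofPath k q) f * ofPath k q := by
  choose t q hc he ht hq using fun r : {r : QPath Q // r.length = i + j} =>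
    QPath.exists_comp_eq r.1 r.2
  -- The right factors of length `j` of the paths that occur in `f`.
  refine ⟨((toFinsupp f).support.subtype fun r => r.length = i + j).image q, ?_, ?_⟩
  · intro s hs
    obtain ⟨r, _, rfl⟩ := Finset.mem_image.1 hs
    exact hq r
  · refine ext_pair fun r => ?_
    rw [map_sum, LinearMap.sum_apply]
    by_cases hr : r.length = i + j
    · have h1 : ofPath k r = ofPath k (t ⟨r, hr⟩) * ofPath k (q ⟨r, hr⟩) := by
        rw [ofPath_mul_ofPath, pathMul, dif_pos (hc _), he]
      have h2 : ∀ s ∈ ((toFinsupp f).support.subtype fun r => r.length = i + j).image q,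
          pair (rdiv (ofPath k s) f * ofPath k s) (ofPath k r) =
            if s = q ⟨r, hr⟩ then pair f (ofPath k r) else 0 := by
        intro s hs
        obtain ⟨r', _, rfl⟩ := Finset.mem_image.1 hs
        rw [h1, pair_mul_ofPath _ (ofPath_mem_degreePart (hq r')) (hq ⟨r, hr⟩),
          pair_ofPath_ofPath]
        split_ifs with h3
        · rw [h3, one_mul, pair_mul_vtx, pair_rdiv, mul_assoc, vtx_mul_ofPath, if_pos rfl]
        · rw [zero_mul]
      rw [Finset.sum_congr rfl h2, Finset.sum_ite_eq']
      split_ifs with h4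
      · rfl
      · by_contra h5
        refine h4 (Finset.mem_image.2 ⟨⟨r, hr⟩, ?_, rfl⟩)
        simpa [pair_ofPath_right] using h5
    · rw [mem_degreePart_iff.1 hf r hr]
      refine (Finset.sum_eq_zero fun s hs => ?_).symm
      obtain ⟨r', _, rfl⟩ := Finset.mem_image.1 hs
      refine mem_degreePart_iff.1 (mul_mem_degreePart (rdiv_mem
        (ofPath_mem_degreePart (hq r')) hf rfl) (ofPath_mem_degreePart (hq r'))) r hr

theorem exists_eq_sum_ldiv {i j : ℕ} {f : PathAlgebra k Q} (hf : f ∈ degreePart k Q (i + j)) :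
    ∃ F : Finset (QPath Q), (∀ p ∈ F, p.length = i) ∧
      f = ∑ p ∈ F, ofPath k p * ldiv (ofPath k p) f := by
  choose t q hc he ht hq using fun r : {r : QPath Q // r.length = i + j} =>
    QPath.exists_comp_eq r.1 r.2
  refine ⟨((toFinsupp f).support.subtype fun r => r.length = i + j).image t, ?_, ?_⟩
  · intro s hs
    obtain ⟨r, _, rfl⟩ := Finset.mem_image.1 hs
    exact ht r
  · refine ext_pair fun r => ?_
    rw [map_sum, LinearMap.sum_apply]
    by_cases hr : r.length = i + j
    · have h1 : ofPath k r = ofPath k (t ⟨r, hr⟩) * ofPath k (q ⟨r, hr⟩) := by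
        rw [ofPath_mul_ofPath, pathMul, dif_pos (hc _), he]
      have h2 : ∀ s ∈ ((toFinsupp f).support.subtype fun r => r.length = i + j).image t,
          pair (ofPath k s * ldiv (ofPath k s) f) (ofPath k r) =
            if s = t ⟨r, hr⟩ then pair f (ofPath k r) else 0 := by
        intro s hs
        obtain ⟨r', _, rfl⟩ := Finset.mem_image.1 hs
        rw [h1, pair_ofPath_mul _ (ofPath_mem_degreePart (ht r')) (ht ⟨r, hr⟩),
          pair_ofPath_ofPath]
        split_ifs with h3
        · rw [h3, one_mul, pair_vtx_mul, pair_ldiv, ← mul_assoc, ofPath_mul_vtx, if_pos rfl]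
        · rw [zero_mul]
      rw [Finset.sum_congr rfl h2, Finset.sum_ite_eq']
      split_ifs with h4
      · rfl
      · by_contra h5
        refine h4 (Finset.mem_image.2 ⟨⟨r, hr⟩, ?_, rfl⟩)
        simpa [pair_ofPath_right] using h5
    · rw [mem_degreePart_iff.1 hf r hr]
      refine (Finset.sum_eq_zero fun s hs => ?_).symm
      obtain ⟨r', _, rfl⟩ := Finset.mem_image.1 hs
      refine mem_degreePart_iff.1 (mul_mem_degreePart (ofPath_mem_degreePart (ht r'))
        (ldiv_mem (ofPath_mem_degreePart (ht r')) hf rfl)) r hr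

theorem eq_sum_mul_vtx (f : PathAlgebra k Q) : ∃ s : Finset Q, f = ∑ x ∈ s, f * vtx k x := by
  refine ⟨(toFinsupp f).support.image QPath.source, ext_pair fun p => ?_⟩
  rw [map_sum, LinearMap.sum_apply]
  have : ∀ x, pair (f * vtx k x) (ofPath k p) =
      if p.source = x then pair f (ofPath k p) else 0 := fun x => by
    rw [pair_mul_vtx, ofPath_mul_vtx]; split_ifs <;> simp
  simp only [this, Finset.sum_ite_eq]
  split_ifs with h
  · rfl
  · by_contra h5
    exact h (Finset.mem_image_of_mem _ (by simpa [pair_ofPath_right] using h5))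

theorem eq_sum_vtx_mul (f : PathAlgebra k Q) : ∃ s : Finset Q, f = ∑ x ∈ s, vtx k x * f := by
  refine ⟨(toFinsupp f).support.image QPath.target, ext_pair fun p => ?_⟩
  rw [map_sum, LinearMap.sum_apply]
  have : ∀ x, pair (vtx k x * f) (ofPath k p) =
      if p.target = x then pair f (ofPath k p) else 0 := fun x => by
    rw [pair_vtx_mul, vtx_mul_ofPath]; split_ifs <;> simp
  simp only [this, Finset.sum_ite_eq]
  split_ifs with h
  · rfl
  · by_contra h5
    exact h (Finset.mem_image_of_mem _ (by simpa [pair_ofPath_right] using h5))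

end PathAlgebra

end

end BoundQuiver

namespace BoundQuiver

noncomputable section

open Classical PathAlgebra

variable {k : Type w} [Field k] {Q : Type u} [Quiver.{v} Q]

/-! ### Quadratic ideals -/

/-- An ideal of `kQ`, as a subspace. -/
def idealSubmodule (R : TwoSidedIdeal (PathAlgebra k Q)) : Submodule k (PathAlgebra k Q) where
  carrier := {f | f ∈ R}
  add_mem' := R.add_mem
  zero_mem' := R.zero_mem
  smul_mem' c _ hf := PathAlgebra.smul_mem R c hf

theorem degreePartFromTo_le (n : ℕ) (x y : Q) :
    degreePartFromTo k n x y ≤ degreePart k Q n := by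
  refine Submodule.span_mono ?_
  rintro _ ⟨p, _, _, hp, rfl⟩
  exact ⟨p, hp, rfl⟩

theorem vtx_mul_mul_vtx_mem {n : ℕ} {f : PathAlgebra k Q} (hf : f ∈ degreePart k Q n) (x y : Q) :
    vtx k y * f * vtx k x ∈ degreePartFromTo k n x y := by
  suffices h : degreePart k Q n ≤ (degreePartFromTo k n x y).comap
      ((mulBilin.flip (vtx k x)).comp (mulBilin (vtx k y))) from h hf
  refine Submodule.span_le.2 ?_
  rintro _ ⟨p, hp, rfl⟩
  change vtx k y * ofPath k p * vtx k x ∈ degreePartFromTo k n x y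
  rw [vtx_mul_ofPath]
  split_ifs with h1
  · rw [ofPath_mul_vtx]
    split_ifs with h2
    · exact Submodule.subset_span ⟨p, h2, h1, hp, rfl⟩
    · exact Submodule.zero_mem _
  · rw [zero_mul]
    exact Submodule.zero_mem _

/-- The products `p s q` of degree `n`, where `p` and `q` are paths and `s` is in `S`. -/
def relationProducts (S : Set (PathAlgebra k Q)) (n : ℕ) : Set (PathAlgebra k Q) :=
  {f | ∃ p q : QPath Q, ∃ s ∈ S, p.length + q.length + 2 = n ∧ f = ofPath k p * s * ofPath k q}

theorem mul_mem_of_paths {N : Submodule k (PathAlgebra k Q)} {f g : PathAlgebra k Q}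
    (h : ∀ p : QPath Q, ofPath k p * g ∈ N) : f * g ∈ N := by
  suffices f ∈ N.comap (mulBilin.flip g) from this
  exact mem_of_paths f fun p _ => h p

theorem mul_mem_of_paths' {N : Submodule k (PathAlgebra k Q)} {f g : PathAlgebra k Q}
    (h : ∀ p : QPath Q, f * ofPath k p ∈ N) : f * g ∈ N := by
  suffices g ∈ N.comap (mulBilin f) from this
  exact mem_of_paths g fun p _ => h p

/-- The span of the products `p s q`, where `p` and `q` are paths and `s` is in `S`. -/
def productSpan (S : Set (PathAlgebra k Q)) : Submodule k (PathAlgebra k Q) :=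
  Submodule.span k {f | ∃ p q : QPath Q, ∃ s ∈ S, f = ofPath k p * s * ofPath k q}

theorem mul_mem_productSpan {S : Set (PathAlgebra k Q)} (a : PathAlgebra k Q)
    {f : PathAlgebra k Q} (hf : f ∈ productSpan S) : a * f ∈ productSpan S := by
  induction hf using Submodule.span_induction with
  | mem f hf =>
    obtain ⟨p, q, s, hs, rfl⟩ := hf
    refine mul_mem_of_paths fun r => ?_
    rw [← mul_assoc, ← mul_assoc, ofPath_mul_ofPath, pathMul]
    split_ifs
    · exact Submodule.subset_span ⟨_, q, s, hs, rfl⟩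
    · rw [zero_mul, zero_mul]
      exact Submodule.zero_mem _
  | zero => rw [mul_zero]; exact Submodule.zero_mem _
  | add f g _ _ hf hg => rw [mul_add]; exact Submodule.add_mem _ hf hg
  | smul c f _ hf => rw [mul_smul_comm]; exact Submodule.smul_mem _ c hf

theorem productSpan_mul_mem {S : Set (PathAlgebra k Q)} (a : PathAlgebra k Q)
    {f : PathAlgebra k Q} (hf : f ∈ productSpan S) : f * a ∈ productSpan S := by
  induction hf using Submodule.span_induction with
  | mem f hf =>
    obtain ⟨p, q, s, hs, rfl⟩ := hf
    refine mul_mem_of_paths' fun r => ?_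
    rw [mul_assoc, ofPath_mul_ofPath, pathMul]
    split_ifs
    · exact Submodule.subset_span ⟨p, _, s, hs, rfl⟩
    · rw [mul_zero]
      exact Submodule.zero_mem _
  | zero => rw [zero_mul]; exact Submodule.zero_mem _
  | add f g _ _ hf hg => rw [add_mul]; exact Submodule.add_mem _ hf hg
  | smul c f _ hf => rw [smul_mul_assoc]; exact Submodule.smul_mem _ c hf

/-- The algebra kQ may lack a unit, so a generator is recovered as the finite sum of its pieces e_y
s e_x. -/
theorem mem_productSpan {S : Set (PathAlgebra k Q)} {f : PathAlgebra k Q}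
    (hf : f ∈ TwoSidedIdeal.span S) : f ∈ productSpan S := by
  induction hf using TwoSidedIdeal.span_induction with
  | mem s hs =>
    obtain ⟨F, hF⟩ := eq_sum_vtx_mul s
    rw [hF]
    refine Submodule.sum_mem _ fun y _ => ?_
    obtain ⟨G, hG⟩ := eq_sum_mul_vtx (vtx k y * s)
    rw [hG]
    exact Submodule.sum_mem _ fun x _ => Submodule.subset_span ⟨_, _, s, hs, rfl⟩
  | zero => exact Submodule.zero_mem _
  | add f g _ _ hf hg => exact Submodule.add_mem _ hf hg
  | neg f _ hf => exact Submodule.neg_mem _ hf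
  | left_absorb a f _ hf => exact mul_mem_productSpan a hf
  | right_absorb a f _ hf => exact productSpan_mul_mem a hf

/-- The spanning products are homogeneous, so a projection keeps exactly those of the right degree.
This makes quadratic ideals graded. -/
theorem proj_mem_span_products {S : Set (PathAlgebra k Q)} (hS : ∀ s ∈ S, s ∈ degreePart k Q 2)
    {f : PathAlgebra k Q} (hf : f ∈ TwoSidedIdeal.span S) (n : ℕ) :
    proj n f ∈ Submodule.span k (relationProducts S n) := by
  suffices h : productSpan S ≤ (Submodule.span k (relationProducts S n)).comap (proj n) from
    h (mem_productSpan hf)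
  refine Submodule.span_le.2 ?_
  rintro _ ⟨p, q, s, hs, rfl⟩
  have hd : ofPath k p * s * ofPath k q ∈ degreePart k Q (p.length + 2 + q.length) :=
    mul_mem_degreePart (mul_mem_degreePart (ofPath_mem_degreePart rfl) (hS s hs))
      (ofPath_mem_degreePart rfl)
  change proj n (ofPath k p * s * ofPath k q) ∈ Submodule.span k (relationProducts S n)
  by_cases h : p.length + 2 + q.length = n
  · rw [proj_eq_self (h ▸ hd)]
    exact Submodule.subset_span ⟨p, q, s, hs, by omega, rfl⟩
  · rw [proj_eq_zero hd h]
    exact Submodule.zero_mem _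

theorem IsQuadratic.proj_mem_span {R : TwoSidedIdeal (PathAlgebra k Q)} (hR : IsQuadratic R)
    {f : PathAlgebra k Q} (hf : f ∈ R) (n : ℕ) :
    proj n f ∈ Submodule.span k (relationProducts {ρ | ρ ∈ R ∧ ρ ∈ degreePart k Q 2} n) := by
  obtain ⟨S, hS, rfl⟩ := hR
  have hS' : ∀ s ∈ S, s ∈ degreePart k Q 2 := fun s hs => by
    obtain ⟨x, y, h⟩ := hS s hs
    exact degreePartFromTo_le _ _ _ h
  refine Submodule.span_mono ?_ (proj_mem_span_products hS' hf n)
  rintro _ ⟨p, q, s, hs, h, rfl⟩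
  exact ⟨p, q, s, ⟨TwoSidedIdeal.subset_span hs, hS' s hs⟩, h, rfl⟩

theorem IsQuadratic.proj_mem {R : TwoSidedIdeal (PathAlgebra k Q)} (hR : IsQuadratic R)
    {f : PathAlgebra k Q} (hf : f ∈ R) (n : ℕ) : proj n f ∈ R := by
  refine (Submodule.span_le (p := idealSubmodule R)).2 ?_ (hR.proj_mem_span hf n)
  rintro _ ⟨p, q, s, hs, -, rfl⟩
  exact R.mul_mem_right _ _ (R.mul_mem_left _ _ hs.1)

/-- No product containing a quadratic relation has degree below two. -/
theorem IsQuadratic.proj_eq_zero {R : TwoSidedIdeal (PathAlgebra k Q)} (hR : IsQuadratic R)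
    {f : PathAlgebra k Q} (hf : f ∈ R) {n : ℕ} (hn : n < 2) : proj n f = 0 := by
  have h := hR.proj_mem_span hf n
  rwa [show relationProducts {ρ | ρ ∈ R ∧ ρ ∈ degreePart k Q 2} n = ∅ from ?_,
    Submodule.span_empty, Submodule.mem_bot] at h
  refine Set.eq_empty_of_forall_notMem ?_
  rintro _ ⟨p, q, s, -, h, rfl⟩
  omega

theorem IsQuadratic.eq_zero {R : TwoSidedIdeal (PathAlgebra k Q)} (hR : IsQuadratic R)
    {f : PathAlgebra k Q} (hf : f ∈ R) {n : ℕ} (hn : n < 2) (hfn : f ∈ degreePart k Q n) :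
    f = 0 := by
  rw [← proj_eq_self hfn, hR.proj_eq_zero hf hn]

/-! ### The subspaces that govern the Koszul complex -/

variable (R : TwoSidedIdeal (PathAlgebra k Q))

/-- The elements of `kQ_n` that satisfy the quadratic relations at all but the last `i` arrows. -/
def koszulPart (i n : ℕ) : Submodule k (PathAlgebra k Q) where
  carrier := {f | f ∈ degreePart k Q n ∧ ∀ p q : QPath Q, i ≤ p.length →
    p.length + q.length + 2 = n → ldiv (ofPath k p) (rdiv (ofPath k q) f) ∈ R}
  add_mem' := fun ⟨h1, h2⟩ ⟨h3, h4⟩ => ⟨add_mem h1 h3, fun p q hp hq => by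
    simpa only [map_add] using R.add_mem (h2 p q hp hq) (h4 p q hp hq)⟩
  zero_mem' := ⟨zero_mem _, fun p q _ _ => by simpa only [map_zero] using R.zero_mem⟩
  smul_mem' := fun c _ ⟨h1, h2⟩ => ⟨Submodule.smul_mem _ c h1, fun p q hp hq => by
    simpa only [map_smul] using PathAlgebra.smul_mem R c (h2 p q hp hq)⟩

/-- The elements of `kQ_n` in the subspace `R_i kQ_{n-i}`. -/
def idealPart (i n : ℕ) : Submodule k (PathAlgebra k Q) where
  carrier := {f | f ∈ degreePart k Q n ∧ ∀ q : QPath Q, i + q.length = n →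
    rdiv (ofPath k q) f ∈ R}
  add_mem' := fun ⟨h1, h2⟩ ⟨h3, h4⟩ => ⟨add_mem h1 h3, fun q hq => by
    simpa only [map_add] using R.add_mem (h2 q hq) (h4 q hq)⟩
  zero_mem' := ⟨zero_mem _, fun q _ => by simpa only [map_zero] using R.zero_mem⟩
  smul_mem' := fun c _ ⟨h1, h2⟩ => ⟨Submodule.smul_mem _ c h1, fun q hq => by
    simpa only [map_smul] using PathAlgebra.smul_mem R c (h2 q hq)⟩

/-- The exactness of all Koszul complexes, as a property of subspaces of `kQ`. -/
def KoszulExact : Prop :=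
  ∀ n i : ℕ, i + 1 < n →
    koszulPart R (i + 1) n ⊓ idealPart R (i + 2) n ≤ idealPart R (i + 1) n ⊔ koszulPart R i n

variable {R}

theorem koszulPart_mul_vtx {i n : ℕ} {f : PathAlgebra k Q} (hf : f ∈ koszulPart R i n) (x : Q) :
    f * vtx k x ∈ koszulPart R i n := by
  refine ⟨mul_vtx_mem hf.1 x, fun p q hp hq => ?_⟩
  rw [← rdiv_vtx, rdiv_rdiv, ofPath_mul_vtx]
  split_ifs
  · exact hf.2 p q hp hq
  · simp

theorem koszulPart_vtx_mul {i n : ℕ} {f : PathAlgebra k Q} (hf : f ∈ koszulPart R i n) (x : Q) :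
    vtx k x * f ∈ koszulPart R i n := by
  refine ⟨vtx_mul_mem hf.1 x, fun p q hp hq => ?_⟩
  rw [← ldiv_vtx, ← ldiv_rdiv, ldiv_ldiv, vtx_mul_ofPath]
  split_ifs
  · exact hf.2 p q hp hq
  · simp

theorem idealPart_mul_vtx {i n : ℕ} {f : PathAlgebra k Q} (hf : f ∈ idealPart R i n) (x : Q) :
    f * vtx k x ∈ idealPart R i n := by
  refine ⟨mul_vtx_mem hf.1 x, fun q hq => ?_⟩
  rw [← rdiv_vtx, rdiv_rdiv, ofPath_mul_vtx]
  split_ifs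
  · exact hf.2 q hq
  · simp

/-- The inequality `hi` amounts to |p| + 2 ≤ i: the relation lies within the left factor of length
`i`, and the remaining `n - i` arrows can be split off from `q`. -/
theorem mul_mem_idealPart_of_le {ρ : PathAlgebra k Q} (hρ : ρ ∈ R) (hρ2 : ρ ∈ degreePart k Q 2)
    {p q : QPath Q} {i n : ℕ} (hn : p.length + q.length + 2 = n) (hi : n ≤ i + q.length) :
    ofPath k p * ρ * ofPath k q ∈ idealPart R i n := by
  refine ⟨?_, fun t ht => ?_⟩
  · have := mul_mem_degreePart (mul_mem_degreePart (ofPath_mem_degreePart (p := p) rfl) hρ2)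
      (ofPath_mem_degreePart (p := q) rfl)
    rwa [show p.length + 2 + q.length = n by omega] at this
  · obtain ⟨a, b, hc, rfl, ha, hb⟩ := q.exists_comp_eq (i := q.length - t.length)
      (j := t.length) (by omega)
    have : ofPath k (a.comp b hc) = ofPath k a * ofPath k b := by
      rw [ofPath_mul_ofPath, pathMul, dif_pos hc]
    rw [this, ← mul_assoc, rdiv_mul _ (ofPath_mem_degreePart hb) rfl]
    exact PathAlgebra.smul_mem R _ (R.mul_mem_right _ _ (R.mul_mem_right _ _
      (R.mul_mem_left _ _ hρ)))

/-! ### Double orthogonals -/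

/-- Extending by a last arrow, only the finiteness of the arrows starting at a vertex is needed. -/
theorem finite_paths (hQ : LocallyFinite Q) (x : Q) (n : ℕ) :
    {p : QPath Q | p.source = x ∧ p.length = n}.Finite := by
  induction n with
  | zero =>
    refine (Set.finite_singleton (QPath.trivial x)).subset ?_
    rintro p ⟨rfl, hp⟩
    exact QPath.eq_trivial_of_length_eq_zero hp
  | succ n ih =>
    have := fun y => (hQ y).1
    refine (ih.biUnion fun p _ => Set.finite_range fun α : Quiver.Star p.2.1 =>
      (⟨p.1, α.1, p.2.2.cons α.2⟩ : QPath Q)).subset ?_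
    rintro ⟨a, b, p⟩ ⟨rfl, hp⟩
    cases p with
    | nil => simp [QPath.length] at hp
    | @cons c _ p α =>
      simp only [Set.mem_iUnion]
      exact ⟨⟨a, c, p⟩, ⟨rfl, by simpa [QPath.length] using hp⟩, ⟨b, α⟩, rfl⟩

/-- A subspace of kQ_n stable under the vertices is its own double orthogonal. One may look at h e_x
alone; a linear form that separates it from `U` is represented by an element of kQ_n, because only
finitely many paths of length `n` start at `x`. -/
theorem mem_of_orthogonal (hQ : LocallyFinite Q) {n : ℕ} {U : Submodule k (PathAlgebra k Q)}
    (hU : ∀ f ∈ U, ∀ x, f * vtx k x ∈ U) (hUn : U ≤ degreePart k Q n) {h : PathAlgebra k Q}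
    (hh : h ∈ degreePart k Q n)
    (H : ∀ g ∈ degreePart k Q n, (∀ f ∈ U, pair g f = 0) → pair g h = 0) : h ∈ U := by
  obtain ⟨s, hs⟩ := eq_sum_mul_vtx h
  rw [hs]
  refine U.sum_mem fun x _ => ?_
  by_contra hx
  obtain ⟨l, hl, hlU⟩ := Submodule.exists_le_ker_of_notMem hx
  set F := (finite_paths hQ x n).toFinset
  -- This element represents the form f ↦ l(f e_x) on kQ_n.
  set g : PathAlgebra k Q := ∑ p ∈ F, l (ofPath k p) • ofPath k p
  have hg : g ∈ degreePart k Q n := Submodule.sum_mem _ fun p hp =>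
    Submodule.smul_mem _ _ (ofPath_mem_degreePart ((finite_paths hQ x n).mem_toFinset.1 hp).2)
  have key : degreePart k Q n ≤
      LinearMap.eqLocus (pair g) (l.comp (mulBilin.flip (vtx k x))) := by
    refine Submodule.span_le.2 ?_
    rintro _ ⟨p, hp, rfl⟩
    change pair g (ofPath k p) = l (ofPath k p * vtx k x)
    simp only [g, map_sum, map_smul, LinearMap.sum_apply, LinearMap.smul_apply,
      pair_ofPath_ofPath, smul_eq_mul, mul_ite, mul_one, mul_zero, Finset.sum_ite_eq',
      ofPath_mul_vtx]
    by_cases hpx : p.source = x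
    · rw [if_pos, if_pos hpx]
      exact (finite_paths hQ x n).mem_toFinset.2 ⟨hpx, hp⟩
    · rw [if_neg, if_neg hpx, map_zero]
      exact fun hm => hpx ((finite_paths hQ x n).mem_toFinset.1 hm).1
  have key' : ∀ f ∈ degreePart k Q n, pair g f = l (f * vtx k x) := fun f hf => key hf
  refine hl ?_
  rw [← key' h hh]
  exact H g hg fun f hf => by rw [key' f (hUn hf)]; exact hlU (hU f hf x)

/-! ### Duality -/

/-- An anti-isomorphism of path algebras given by a bijection of paths. -/
structure PathDuality (k : Type w) [Field k] (Q : Type u) [Quiver.{v} Q] (Q' : Type u)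
    [Quiver.{v} Q'] where
  /-- The anti-isomorphism. -/
  map : PathAlgebra k Q ≃ₗ[k] PathAlgebra k Q'
  /-- The bijection of paths. -/
  path : QPath Q ≃ QPath Q'
  map_mul : ∀ f g, map (f * g) = map g * map f
  map_ofPath : ∀ p, map (ofPath k p) = ofPath k (path p)
  length_path : ∀ p, (path p).length = p.length

namespace PathDuality

variable {Q' : Type u} [Quiver.{v} Q'] (σ : PathDuality k Q Q')

/-- The inverse of an anti-isomorphism. -/
def symm : PathDuality k Q' Q where
  map := σ.map.symm
  path := σ.path.symm
  map_mul f g := by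
    apply σ.map.injective
    rw [σ.map_mul]
    simp
  map_ofPath p := by
    apply σ.map.injective
    rw [σ.map_ofPath]
    simp
  length_path p := by
    rw [← σ.length_path]
    simp

theorem map_symm_map (f : PathAlgebra k Q') : σ.map (σ.symm.map f) = f :=
  σ.map.apply_symm_apply f

theorem symm_map_map (f : PathAlgebra k Q) : σ.symm.map (σ.map f) = f :=
  σ.map.symm_apply_apply f

theorem pair_map (f g : PathAlgebra k Q) : pair (σ.map f) (σ.map g) = pair f g := by
  have : (pair.compl₁₂ σ.map.toLinearMap σ.map.toLinearMap :
      PathAlgebra k Q →ₗ[k] PathAlgebra k Q →ₗ[k] k) = pair := by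
    refine linearMap_ext fun p => linearMap_ext fun q => ?_
    simp [LinearMap.compl₁₂_apply, σ.map_ofPath, pair_ofPath_ofPath]
  exact LinearMap.congr_fun (LinearMap.congr_fun this f) g

theorem pair_symm_map (f : PathAlgebra k Q) (g : PathAlgebra k Q') :
    pair f (σ.symm.map g) = pair (σ.map f) g := by
  rw [← σ.pair_map, σ.map_symm_map]

theorem map_mem {n : ℕ} {f : PathAlgebra k Q} (hf : f ∈ degreePart k Q n) :
    σ.map f ∈ degreePart k Q' n := by
  suffices h : degreePart k Q n ≤ (degreePart k Q' n).comap σ.map.toLinearMap from h hf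
  refine Submodule.span_le.2 ?_
  rintro _ ⟨p, hp, rfl⟩
  change σ.map (ofPath k p) ∈ degreePart k Q' n
  rw [σ.map_ofPath]
  exact ofPath_mem_degreePart ((σ.length_path p).trans hp)

/-- The relations of degree two in `R'` are those orthogonal to the ones in `R`. -/
def IsDual (R : TwoSidedIdeal (PathAlgebra k Q)) (R' : TwoSidedIdeal (PathAlgebra k Q')) : Prop :=
  ∀ f ∈ degreePart k Q 2, σ.map f ∈ R' ↔ ∀ g ∈ R, g ∈ degreePart k Q 2 → pair f g = 0

variable {σ} {R' : TwoSidedIdeal (PathAlgebra k Q')}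

/-- The degree two part of `R` is its own double orthogonal. -/
theorem IsDual.symm (hQ : LocallyFinite Q) (h : σ.IsDual R R') : σ.symm.IsDual R' R := by
  intro f' hf'
  constructor
  · intro hf g' hg' hg2
    rw [← σ.map_symm_map f', ← σ.pair_symm_map, pair_comm]
    exact (h _ (σ.symm.map_mem hg2)).1 (by rwa [σ.map_symm_map]) _ hf (σ.symm.map_mem hf')
  · intro H
    refine (mem_of_orthogonal hQ (n := 2) (U := idealSubmodule R ⊓ degreePart k Q 2)
      (fun f hf x => ⟨R.mul_mem_right _ _ hf.1, mul_vtx_mem hf.2 x⟩) inf_le_right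
      (σ.symm.map_mem hf') fun g hg hgU => ?_).1
    rw [σ.pair_symm_map, pair_comm]
    exact H _ ((h g hg).2 fun f hf hf2 => hgU f ⟨hf, hf2⟩) (σ.map_mem hg)

theorem IsDual.pair_eq_zero (h : σ.IsDual R R') {f : PathAlgebra k Q} {f' : PathAlgebra k Q'}
    (hf : f ∈ R) (hf2 : f ∈ degreePart k Q 2) (hf' : f' ∈ R') (hf2' : f' ∈ degreePart k Q' 2) :
    pair (σ.map f) f' = 0 := by
  rw [← σ.pair_symm_map, pair_comm]
  exact (h _ (σ.symm.map_mem hf2')).1 (by rwa [σ.map_symm_map]) f hf hf2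

/-- An element of R_l kQ_m is a combination of products p ρ s with |s| ≥ m and ρ a quadratic
relation. Reversal makes `s` the left factor, at a place where the elements of the Koszul part
satisfy the dual relations; moving the outer paths across the pairing leaves ρ against an element of
`R'` of degree two. -/
theorem IsDual.pair_idealPart (h : σ.IsDual R R') (hR : IsQuadratic R) {l m n : ℕ}
    (hn : l + m = n) {b : PathAlgebra k Q} (hb : b ∈ idealPart R l n) {f' : PathAlgebra k Q'}
    (hf' : f' ∈ koszulPart R' m n) : pair (σ.map b) f' = 0 := by
  subst hn
  obtain ⟨F, hF, hbF⟩ := exists_eq_sum_rdiv hb.1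
  rw [hbF, map_sum, map_sum, LinearMap.sum_apply]
  refine Finset.sum_eq_zero fun q hq => ?_
  have hr := hb.2 q (by rw [hF q hq])
  have hr2 : rdiv (ofPath k q) b ∈ degreePart k Q l :=
    rdiv_mem (ofPath_mem_degreePart (hF q hq)) hb.1 rfl
  generalize rdiv (ofPath k q) b = r at hr hr2
  have h1 := hR.proj_mem_span hr l
  rw [proj_eq_self hr2] at h1
  suffices h2 : Submodule.span k (relationProducts {ρ | ρ ∈ R ∧ ρ ∈ degreePart k Q 2} l) ≤
      LinearMap.ker ((pair.flip f').comp (σ.map.toLinearMap.comp (mulBilin.flip (ofPath k q))))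
    from h2 h1
  refine Submodule.span_le.2 ?_
  rintro _ ⟨p, s, ρ, ⟨hρ, hρ2⟩, hl, rfl⟩
  change pair (σ.map (ofPath k p * ρ * ofPath k s * ofPath k q)) f' = 0
  rw [mul_assoc, ofPath_mul_ofPath, pathMul]
  split_ifs with hc
  · rw [σ.map_mul, σ.map_mul, σ.map_ofPath, σ.map_ofPath, ← mul_assoc, pair_comm, ← pair_rdiv,
      ← pair_ldiv, pair_comm]
    have hlen : (s.comp q hc).length = s.length + m := by rw [QPath.length_comp, hF q hq]
    refine h.pair_eq_zero hρ hρ2 (hf'.2 _ _ ?_ ?_) (ldiv_mem (ofPath_mem_degreePart rfl)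
      (rdiv_mem (l := s.length + m + 2) (ofPath_mem_degreePart rfl) hf'.1 ?_) ?_)
    all_goals (simp only [σ.length_path, hlen]; try omega)
  · simp

/-- The orthogonal of A_{i+1} ∩ B_{i+2} ⊆ B_{i+1} + A_i is the same inclusion for `R'`. To place
`f'` on the right-hand side, it is tested against every `g'` orthogonal to that side; the preimage
`g` then lies on the left-hand side of the inclusion for `R`. -/
theorem IsDual.koszulExact (hQ : LocallyFinite Q) (hQ' : LocallyFinite Q') (h : σ.IsDual R R')
    (hR : IsQuadratic R) (hR' : IsQuadratic R') (hE : KoszulExact R) : KoszulExact R' := by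
  intro n j hj f' hf'
  -- The dual index: i + j = n - 2.
  obtain ⟨i, rfl⟩ : ∃ i, n = i + 1 + (j + 1) := ⟨n - (j + 2), by omega⟩
  refine mem_of_orthogonal hQ' (n := i + 1 + (j + 1)) ?_
    (sup_le (fun _ h => h.1) (fun _ h => h.1)) hf'.1.1 fun g' hg' hgU => ?_
  · intro f hf x
    obtain ⟨b, hb, a, ha, rfl⟩ := Submodule.mem_sup.1 hf
    rw [add_mul]
    exact Submodule.add_mem_sup (idealPart_mul_vtx hb x) (koszulPart_mul_vtx ha x)
  have hs := h.symm hQ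
  obtain ⟨g, rfl⟩ := σ.map.surjective g'
  have hg : g ∈ degreePart k Q (i + 1 + (j + 1)) := by
    rw [← σ.symm_map_map g]; exact σ.symm.map_mem hg'
  -- Orthogonality to the products q ρ' p in B'_{j+1}, with the reversed paths outside, says that g
  -- satisfies the relations at the required places.
  have hg1 : g ∈ koszulPart R (i + 1) (i + 1 + (j + 1)) := by
    refine ⟨hg, fun p q hp hq => ?_⟩
    set x := ldiv (ofPath k p) (rdiv (ofPath k q) g) with hx
    have hx2 : x ∈ degreePart k Q 2 := ldiv_mem (ofPath_mem_degreePart rfl)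
      (rdiv_mem (l := p.length + 2) (ofPath_mem_degreePart rfl) hg (by omega)) rfl
    rw [← σ.symm_map_map x]
    refine (hs _ (σ.map_mem hx2)).2 fun ρ hρ hρ2 => ?_
    rw [← σ.pair_symm_map, hx, pair_ldiv, pair_rdiv, ← σ.pair_map, σ.map_mul, σ.map_mul,
      σ.map_ofPath, σ.map_ofPath, σ.map_symm_map, ← mul_assoc]
    refine hgU _ (Submodule.mem_sup_left (mul_mem_idealPart_of_le hρ hρ2 ?_ ?_)) <;>
      simp only [σ.length_path] <;> omega
  have hg2 : g ∈ idealPart R (i + 2) (i + 1 + (j + 1)) := by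
    refine ⟨hg, fun q hq => ?_⟩
    -- R_{i+2} is its own double orthogonal, so the quotient of `g` by `q` may be tested against
    -- elements `u` orthogonal to R_{i+2}.
    refine (mem_of_orthogonal hQ (n := i + 2) (U := idealSubmodule R ⊓ degreePart k Q (i + 2))
      (fun f hf x => ⟨R.mul_mem_right _ _ hf.1, mul_vtx_mem hf.2 x⟩) inf_le_right
      (rdiv_mem (ofPath_mem_degreePart rfl) hg hq.symm) fun u hu huU => ?_).1
    rw [pair_comm, pair_rdiv, ← σ.pair_map, σ.map_mul, σ.map_ofPath]
    have hql : (σ.path q).length = j := by rw [σ.length_path]; omega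
    have hu' := σ.map_mem hu
    -- Since `u` is orthogonal to all products of degree i + 2 containing a relation of `R`, its
    -- reversal satisfies the dual relations everywhere. Hence reversed `q` times reversed `u` lies
    -- in A'_j, to which `g'` is orthogonal.
    refine hgU _ (Submodule.mem_sup_right ⟨?_, fun p s hp hps => ?_⟩)
    · have := mul_mem_degreePart (ofPath_mem_degreePart hql) hu'
      rwa [show j + (i + 2) = i + 1 + (j + 1) by omega] at this
    · obtain ⟨a, b, hc, rfl, ha, hb⟩ := p.exists_comp_eq (i := j) (j := p.length - j) (by omega)
      rw [QPath.length_comp] at hp hps hb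
      have : ofPath k (a.comp b hc) = ofPath k a * ofPath k b := by
        rw [ofPath_mul_ofPath, pathMul, dif_pos hc]
      rw [this, ← ldiv_ldiv, ldiv_rdiv, ldiv_mul _ (ofPath_mem_degreePart hql) ha, map_smul,
        map_smul, ← ldiv_vtx, ← ldiv_rdiv, ldiv_ldiv, vtx_mul_ofPath, if_pos hc]
      refine PathAlgebra.smul_mem R' _ ?_
      set x' := ldiv (ofPath k b) (rdiv (ofPath k s) (σ.map u)) with hx'
      have hx2 : x' ∈ degreePart k Q' 2 := ldiv_mem (ofPath_mem_degreePart rfl)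
        (rdiv_mem (l := b.length + 2) (ofPath_mem_degreePart rfl) hu' (by omega)) rfl
      rw [← σ.map_symm_map x']
      refine (h _ (σ.symm.map_mem hx2)).2 fun ρ hρ hρ2 => ?_
      rw [pair_comm, σ.pair_symm_map, pair_comm, hx', pair_ldiv, pair_rdiv, ← σ.pair_symm_map,
        σ.symm.map_mul, σ.symm.map_mul, σ.symm_map_map, σ.symm.map_ofPath, σ.symm.map_ofPath]
      refine huU _ ⟨R.mul_mem_left _ _ (R.mul_mem_right _ _ hρ), ?_⟩
      have := mul_mem_degreePart (ofPath_mem_degreePart (p := σ.symm.path s) (k := k) rfl)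
        (mul_mem_degreePart hρ2 (ofPath_mem_degreePart (p := σ.symm.path b) (k := k) rfl))
      simp only [σ.symm.length_path] at this
      rwa [show s.length + (2 + b.length) = i + 2 by omega] at this
  -- The term in B_{i+1} is orthogonal to f' as an element of A'_{j+1}, and the term in A_i is
  -- orthogonal to f' as an element of B'_{j+2}.
  obtain ⟨b, hb, a, ha, rfl⟩ := Submodule.mem_sup.1 (hE _ i (by omega) ⟨hg1, hg2⟩)
  rw [map_add, map_add, LinearMap.add_apply, h.pair_idealPart hR rfl hb hf'.1, zero_add,
    ← σ.pair_symm_map, pair_comm]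
  exact hs.pair_idealPart hR' (by omega) hf'.2 ha

end PathDuality

end

end BoundQuiver

namespace BoundQuiver

noncomputable section

open Classical PathAlgebra Opposite

variable {k : Type w} [Field k] {Q : Type u} [Quiver.{v} Q]

/-! ### The opposite quiver -/

namespace QPath

theorem opPath_comp {x y : Q} (p : Quiver.Path x y) {z : Q} (q : Quiver.Path y z) :
    opPath (p.comp q) = (opPath q).comp (opPath p) := by
  induction q with
  | nil => simp [opPath]
  | cons q α ih => simp [opPath, ih]

theorem length_opPath {x y : Q} (p : Quiver.Path x y) : (opPath p).length = p.length := by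
  induction p with
  | nil => rfl
  | cons p α ih => simp [opPath, ih, add_comm]

/-- The reversed path of a path in the opposite quiver. -/
def unopPath {x : Qᵒᵖ} : {y : Qᵒᵖ} → Quiver.Path x y → Quiver.Path (unop y) (unop x)
  | _, Quiver.Path.nil => Quiver.Path.nil
  | _, Quiver.Path.cons p α => (Quiver.Hom.toPath (Quiver.Hom.unop α)).comp (unopPath p)

theorem unopPath_comp {x y : Qᵒᵖ} (p : Quiver.Path x y) {z : Qᵒᵖ} (q : Quiver.Path y z) :
    unopPath (p.comp q) = (unopPath q).comp (unopPath p) := by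
  induction q with
  | nil => simp [unopPath]
  | cons q α ih => simp [unopPath, ih]

theorem unopPath_opPath {x y : Q} (p : Quiver.Path x y) : unopPath (opPath p) = p := by
  induction p with
  | nil => rfl
  | cons p α ih =>
    rw [opPath, unopPath_comp, ih]
    rfl

theorem opPath_unopPath {x y : Qᵒᵖ} (p : Quiver.Path x y) : opPath (unopPath p) = p := by
  induction p with
  | nil => rfl
  | cons p α ih =>
    rw [unopPath, opPath_comp, ih]
    rfl

variable (Q) in
/-- The reversal of paths. -/
def opEquiv : QPath Q ≃ QPath Qᵒᵖ where
  toFun := op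
  invFun p := ⟨unop p.2.1, unop p.1, unopPath p.2.2⟩
  left_inv p := by
    obtain ⟨x, y, p⟩ := p
    simp [op, unopPath_opPath]
  right_inv p := by
    obtain ⟨x, y, p⟩ := p
    simp [op, opPath_unopPath]

theorem op_comp (p q : QPath Q) (h : q.target = p.source) :
    op (p.comp q h) = (op q).comp (op p) (congrArg Opposite.op h.symm) := by
  obtain ⟨p₁, p₂, p⟩ := p
  obtain ⟨q₁, q₂, q⟩ := q
  obtain rfl : q₂ = p₁ := h
  change (⟨_, _, opPath (q.comp p)⟩ : QPath Qᵒᵖ) = ⟨_, _, (opPath p).comp (opPath q)⟩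
  rw [opPath_comp]

end QPath

/-! ### Reversal as a duality between `R` and its quadratic dual -/

theorem op_ofPath (p : QPath Q) : PathAlgebra.op (ofPath k p) = ofPath k p.op := by
  simp [PathAlgebra.op, ofPath]

theorem op_mul (f g : PathAlgebra k Q) :
    PathAlgebra.op (f * g) = PathAlgebra.op g * PathAlgebra.op f := by
  have : (mulBilin.compr₂ PathAlgebra.op :
      PathAlgebra k Q →ₗ[k] PathAlgebra k Q →ₗ[k] PathAlgebra k Qᵒᵖ) =
      (mulBilin.compl₁₂ PathAlgebra.op PathAlgebra.op).flip := by
    refine linearMap_ext fun p => linearMap_ext fun q => ?_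
    change PathAlgebra.op (ofPath k p * ofPath k q) =
      PathAlgebra.op (ofPath k q) * PathAlgebra.op (ofPath k p)
    rw [op_ofPath, op_ofPath, ofPath_mul_ofPath, ofPath_mul_ofPath]
    by_cases h : q.target = p.source
    · have h' : p.op.target = q.op.source := congrArg Opposite.op h.symm
      rw [pathMul, dif_pos h, pathMul, dif_pos h', op_ofPath, QPath.op_comp]
    · have h' : ¬p.op.target = q.op.source := fun h' => h (op_injective h').symm
      rw [pathMul, dif_neg h, pathMul, dif_neg h', map_zero]
  exact LinearMap.congr_fun (LinearMap.congr_fun this f) g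

variable (k Q) in
/-- The anti-isomorphism from `kQ` to the path algebra of the opposite quiver. -/
def opDuality : PathDuality k Q Qᵒᵖ where
  map := toFinsupp.trans ((Finsupp.domLCongr (QPath.opEquiv Q)).trans toFinsupp.symm)
  path := QPath.opEquiv Q
  map_mul f g := by
    have h : (toFinsupp.trans ((Finsupp.domLCongr (QPath.opEquiv Q)).trans
        toFinsupp.symm)).toLinearMap = (PathAlgebra.op : PathAlgebra k Q →ₗ[k] _) :=
      linearMap_ext fun p => by rw [op_ofPath]; simp [ofPath, QPath.opEquiv]
    have h' := fun f => LinearMap.congr_fun h f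
    simp only [LinearEquiv.coe_coe] at h'
    rw [h', h', h', op_mul]
  map_ofPath p := by simp [ofPath]
  length_path p := QPath.length_opPath p.2.2

theorem opDuality_map (f : PathAlgebra k Q) : (opDuality k Q).map f = PathAlgebra.op f := by
  have h : (opDuality k Q).map.toLinearMap = PathAlgebra.op :=
    linearMap_ext fun p => by
      rw [op_ofPath]; exact (opDuality k Q).map_ofPath p
  exact LinearMap.congr_fun h f

theorem LocallyFinite.op (hQ : LocallyFinite Q) : LocallyFinite Qᵒᵖ := by
  intro x
  have h1 := (hQ (unop x)).1
  have h2 := (hQ (unop x)).2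
  constructor
  · refine Finite.of_injective (β := Quiver.Costar (unop x))
      (fun α => ⟨unop α.1, Quiver.Hom.unop α.2⟩) ?_
    rintro ⟨y, α⟩ ⟨z, β⟩ h
    simp only [Sigma.mk.injEq] at h
    obtain rfl := unop_injective h.1
    have h2 := eq_of_heq h.2
    simpa using unop_injective h2
  · refine Finite.of_injective (β := Quiver.Star (unop x))
      (fun α => ⟨unop α.1, Quiver.Hom.unop α.2⟩) ?_
    rintro ⟨y, α⟩ ⟨z, β⟩ h
    simp only [Sigma.mk.injEq] at h
    obtain rfl := unop_injective h.1
    have h2 := eq_of_heq h.2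
    simpa using unop_injective h2

theorem op_mem_degreePartFromTo {n : ℕ} {x y : Q} {f : PathAlgebra k Q}
    (hf : f ∈ degreePartFromTo k n x y) :
    PathAlgebra.op f ∈ degreePartFromTo k n (op y) (op x) := by
  suffices h : degreePartFromTo k n x y ≤
      (degreePartFromTo k n (op y) (op x)).comap PathAlgebra.op from h hf
  refine Submodule.span_le.2 ?_
  rintro _ ⟨p, rfl, rfl, hp, rfl⟩
  change PathAlgebra.op (ofPath k p) ∈ degreePartFromTo k n (op p.target) (op p.source)
  rw [op_ofPath]
  exact Submodule.subset_span ⟨p.op, rfl, rfl, (QPath.length_opPath p.2.2).trans hp, rfl⟩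

theorem isQuadratic_quadraticDual (R : TwoSidedIdeal (PathAlgebra k Q)) :
    IsQuadratic (quadraticDual R) := by
  refine ⟨_, ?_, rfl⟩
  rintro _ ⟨x, y, ρ, hρ, -, rfl⟩
  exact ⟨_, _, op_mem_degreePartFromTo hρ⟩

/-- In degree two, the ideal R^! is spanned by its generators multiplied by vertices. Since `R` is
stable under the vertices, orthogonality in kQ_2 can be tested separately on each kQ_2(x, y). -/
theorem opDuality_isDual (R : TwoSidedIdeal (PathAlgebra k Q)) :
    (opDuality k Q).IsDual R (quadraticDual R) := by
  intro f hf
  set S : Set (PathAlgebra k Qᵒᵖ) := {σ | ∃ x y : Q, ∃ ρ ∈ degreePartFromTo k 2 x y,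
      (∀ γ ∈ R, γ ∈ degreePartFromTo k 2 x y → starPairing ρ γ = 0) ∧ σ = PathAlgebra.op ρ} with hS
  have hS2 : ∀ s ∈ S, s ∈ degreePart k Qᵒᵖ 2 := by
    rintro _ ⟨x, y, ρ, hρ, -, rfl⟩
    exact degreePartFromTo_le _ _ _ (op_mem_degreePartFromTo hρ)
  constructor
  · intro h g hg hg2
    have h1 := proj_mem_span_products hS2 h 2
    rw [proj_eq_self ((opDuality k Q).map_mem hf)] at h1
    rw [← (opDuality k Q).pair_map]
    suffices h2 : Submodule.span k (relationProducts S 2) ≤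
        LinearMap.ker (pair.flip ((opDuality k Q).map g)) from h2 h1
    refine Submodule.span_le.2 ?_
    rintro _ ⟨p, q, _, ⟨x, y, ρ, hρ, hρR, rfl⟩, hpq, rfl⟩
    change pair _ ((opDuality k Q).map g) = 0
    obtain ⟨p, rfl⟩ := (opDuality k Q).path.surjective p
    obtain ⟨q, rfl⟩ := (opDuality k Q).path.surjective q
    rw [(opDuality k Q).length_path, (opDuality k Q).length_path] at hpq
    rw [← opDuality_map, ← (opDuality k Q).map_ofPath, ← (opDuality k Q).map_ofPath,
      ← (opDuality k Q).map_mul, ← (opDuality k Q).map_mul, (opDuality k Q).pair_map,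
      QPath.eq_trivial_of_length_eq_zero (p := p) (by omega),
      QPath.eq_trivial_of_length_eq_zero (p := q) (by omega), ← vtx, ← vtx, pair_vtx_mul,
      pair_mul_vtx]
    -- With this, all vertices can be moved onto `g`, and the truncated `g` lies in R ∩ kQ_2(x, y).
    have hρ' : vtx k y * ρ * vtx k x = ρ := by
      suffices h3 : degreePartFromTo k 2 x y ≤ LinearMap.eqLocus
          ((mulBilin.flip (vtx k x)).comp (mulBilin (vtx k y))) LinearMap.id from h3 hρ
      refine Submodule.span_le.2 ?_
      rintro _ ⟨r, rfl, rfl, -, rfl⟩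
      change vtx k r.target * ofPath k r * vtx k r.source = ofPath k r
      rw [vtx_mul_ofPath, if_pos rfl, ofPath_mul_vtx, if_pos rfl]
    rw [← hρ', pair_mul_vtx, pair_vtx_mul, ← starPairing_eq_pair, ← mul_assoc]
    refine hρR _ (R.mul_mem_right _ _ (R.mul_mem_left _ _ (R.mul_mem_right _ _
      (R.mul_mem_left _ _ hg)))) (vtx_mul_mul_vtx_mem (mul_vtx_mem (vtx_mul_mem hg2 _) _) _ _)
  · intro H
    rw [opDuality_map]
    suffices f ∈ (idealSubmodule (quadraticDual R)).comap PathAlgebra.op from this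
    obtain ⟨F, hF⟩ := eq_sum_vtx_mul f
    rw [hF]
    refine Submodule.sum_mem _ fun y _ => ?_
    obtain ⟨G, hG⟩ := eq_sum_mul_vtx (vtx k y * f)
    rw [hG]
    refine Submodule.sum_mem _ fun x _ => TwoSidedIdeal.subset_span
      ⟨x, y, _, vtx_mul_mul_vtx_mem hf x y, fun γ hγ hγ2 => ?_, rfl⟩
    rw [starPairing_eq_pair, pair_mul_vtx, pair_vtx_mul]
    exact H _ (R.mul_mem_left _ _ (R.mul_mem_right _ _ hγ))
      (vtx_mul_mem (mul_vtx_mem (degreePartFromTo_le _ _ _ hγ2) _) _)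

/-- The converse uses the inverse duality; no identification of the double opposite quiver with Q is
needed. -/
theorem koszulExact_quadraticDual_iff (hQ : LocallyFinite Q)
    {R : TwoSidedIdeal (PathAlgebra k Q)} (hR : IsQuadratic R) :
    KoszulExact R ↔ KoszulExact (quadraticDual R) :=
  ⟨(opDuality_isDual R).koszulExact hQ hQ.op hR (isQuadratic_quadraticDual R),
    ((opDuality_isDual R).symm hQ).koszulExact hQ.op hQ (isQuadratic_quadraticDual R) hR⟩

end

end BoundQuiver

namespace BoundQuiver

noncomputable section

open Classical PathAlgebra

variable {k : Type w} [Field k] {Q : Type u} [Quiver.{v} Q]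
  {R : TwoSidedIdeal (PathAlgebra k Q)}

/-! ### Elements of degree zero and calculus of the Koszul and ideal parts -/

namespace PathAlgebra

theorem proj_zero_mul (f g : PathAlgebra k Q) : proj 0 (f * g) = proj 0 f * proj 0 g := by
  have : (mulBilin.compr₂ (proj 0) : PathAlgebra k Q →ₗ[k] PathAlgebra k Q →ₗ[k] _) =
      mulBilin.compl₁₂ (proj 0) (proj 0) := by
    refine linearMap_ext fun p => linearMap_ext fun q => ?_
    change proj 0 (ofPath k p * ofPath k q) = proj 0 (ofPath k p) * proj 0 (ofPath k q)
    have hd := mul_mem_degreePart (ofPath_mem_degreePart (k := k) (p := p) rfl)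
      (ofPath_mem_degreePart (k := k) (p := q) rfl)
    rw [proj_ofPath, proj_ofPath]
    split_ifs with h1 h2 h2
    · rw [h1, h2] at hd
      exact proj_eq_self hd
    · rw [mul_zero, proj_eq_zero hd (by omega)]
    · rw [zero_mul, proj_eq_zero hd (by omega)]
    · rw [zero_mul, proj_eq_zero hd (by omega)]
  exact LinearMap.congr_fun (LinearMap.congr_fun this f) g

theorem exists_smul_vtx {f : PathAlgebra k Q} (hf : f ∈ degreePart k Q 0) (x : Q) :
    ∃ c : k, f * vtx k x = c • vtx k x := by
  suffices h : degreePart k Q 0 ≤ (Submodule.span k {vtx k x}).comap (mulBilin.flip (vtx k x)) by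
    obtain ⟨c, hc⟩ := Submodule.mem_span_singleton.1 (h hf)
    exact ⟨c, hc.symm⟩
  refine Submodule.span_le.2 ?_
  rintro _ ⟨p, hp, rfl⟩
  change ofPath k p * vtx k x ∈ Submodule.span k {vtx k x}
  rw [ofPath_mul_vtx]
  split_ifs with h
  · rw [QPath.eq_trivial_of_length_eq_zero hp, h]
    exact Submodule.mem_span_singleton_self _
  · exact Submodule.zero_mem _

theorem mem_of_forall_vtx_mul_mem {f : PathAlgebra k Q} (h : ∀ y, vtx k y * f ∈ R) : f ∈ R := by
  obtain ⟨F, hF⟩ := eq_sum_vtx_mul f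
  rw [hF]
  exact sum_mem fun y _ => h y

end PathAlgebra

theorem koszulPart_eq {i n : ℕ} (h : n < i + 2) : koszulPart R i n = degreePart k Q n :=
  le_antisymm (fun _ hf => hf.1) fun _ hf => ⟨hf, fun p q hp hq => by omega⟩

theorem koszulPart_mono {i i' n : ℕ} (h : i ≤ i') : koszulPart R i n ≤ koszulPart R i' n :=
  fun _ hf => ⟨hf.1, fun p q hp hq => hf.2 p q (h.trans hp) hq⟩

/-- The relation at the two leftmost arrows is the case of a trivial left path. It is collected over
all end vertices because kQ may have no unit. -/
theorem koszulPart_zero_le_idealPart (n : ℕ) : koszulPart R 0 n ≤ idealPart R 2 n := by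
  refine fun f hf => ⟨hf.1, fun q hq => mem_of_forall_vtx_mul_mem fun y => ?_⟩
  rw [← ldiv_vtx]
  exact hf.2 (QPath.trivial y) q (Nat.zero_le _) (by rw [QPath.length_trivial]; omega)

/-- The first condition covers every position except the leftmost, and the second covers that one.
-/
theorem koszulPart_one_inf_le (n : ℕ) :
    koszulPart R 1 n ⊓ idealPart R 2 n ≤ koszulPart R 0 n := by
  rintro f ⟨h1, h2⟩
  refine ⟨h1.1, fun p q _ hq => ?_⟩
  by_cases hp : 1 ≤ p.length
  · exact h1.2 p q hp hq
  · rw [QPath.eq_trivial_of_length_eq_zero (p := p) (by omega), ← vtx, ldiv_vtx]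
    exact R.mul_mem_left _ _ (h2.2 q (by omega))

/-- R_1 = 0. This makes the Koszul differential injective on the terms with Λ_0. -/
theorem idealPart_one_eq_bot (hR : IsQuadratic R) (n : ℕ) : idealPart R 1 (n + 1) = ⊥ := by
  refine (Submodule.eq_bot_iff _).2 fun f hf => ?_
  obtain ⟨F, hF, hfF⟩ := exists_eq_sum_rdiv (i := 1) (j := n) (by rw [add_comm]; exact hf.1)
  rw [hfF]
  refine Finset.sum_eq_zero fun q hq => ?_
  rw [hR.eq_zero (hf.2 q (by rw [hF q hq, add_comm])) one_lt_two
    (rdiv_mem (ofPath_mem_degreePart rfl) hf.1 (by rw [hF q hq, add_comm])), zero_mul]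

theorem mul_mem_idealPart {i j n : ℕ} (hn : i + j = n) {f g : PathAlgebra k Q} (hf : f ∈ R)
    (hfi : f ∈ degreePart k Q i) (hg : g ∈ degreePart k Q j) : f * g ∈ idealPart R i n := by
  subst hn
  refine ⟨mul_mem_degreePart hfi hg, fun q hq => ?_⟩
  rw [rdiv_mul f hg (by omega)]
  exact PathAlgebra.smul_mem R _ (R.mul_mem_right _ _ hf)

/-- With `ldiv_mem_koszulPart`, this identifies the Koszul part with kQ_i K_{n-i}: dividing by the
first `i` arrows from the left gives multiples of `g`, cut at a vertex. -/
theorem mul_mem_koszulPart {i j n : ℕ} (hn : i + j = n) {f g : PathAlgebra k Q}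
    (hf : f ∈ degreePart k Q i) (hg : g ∈ koszulPart R 0 j) : f * g ∈ koszulPart R i n := by
  subst hn
  refine ⟨mul_mem_degreePart hf hg.1, fun p q hp hq => ?_⟩
  obtain ⟨a, b, hc, rfl, ha, hb⟩ := p.exists_comp_eq (i := i) (j := p.length - i) (by omega)
  have : ofPath k (a.comp b hc) = ofPath k a * ofPath k b := by
    rw [ofPath_mul_ofPath, pathMul, dif_pos hc]
  rw [this, ← ldiv_ldiv, ldiv_rdiv, ldiv_mul _ hf ha, map_smul, map_smul]
  refine PathAlgebra.smul_mem R _ ((koszulPart_vtx_mul hg _).2 _ _ (Nat.zero_le _) ?_)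
  rw [QPath.length_comp] at hq
  omega

theorem ldiv_mem_koszulPart {i j n : ℕ} (hn : i + j = n) {g : PathAlgebra k Q}
    (hg : g ∈ koszulPart R i n) {p : QPath Q} (hp : p.length = i) :
    ldiv (ofPath k p) g ∈ koszulPart R 0 j := by
  refine ⟨ldiv_mem (ofPath_mem_degreePart hp) hg.1 hn.symm, fun s q _ hq => ?_⟩
  rw [← ldiv_rdiv, ldiv_ldiv, ofPath_mul_ofPath, pathMul]
  split_ifs with hc
  · refine hg.2 _ _ ?_ ?_ <;> rw [QPath.length_comp] <;> omega
  · simp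

/-! ### Bases of the spaces that generate the Koszul complex -/

/-- A basis of `K_n e_a`, where `K_n` is the part of `kQ_n` that satisfies the quadratic relations
everywhere, whose elements end at the vertices `x s`. -/
structure IsKoszulBasis (R : TwoSidedIdeal (PathAlgebra k Q)) (a : Q) (n : ℕ) {r : ℕ}
    (x : Fin r → Q) (φ : Fin r → PathAlgebra k Q) : Prop where
  mem : ∀ s, φ s ∈ koszulPart R 0 n
  mul_vtx : ∀ s, φ s * vtx k a = φ s
  vtx_mul : ∀ s, vtx k (x s) * φ s = φ s
  linearIndependent : LinearIndependent k φ
  span : ∀ g ∈ koszulPart R 0 n, g * vtx k a = g → ∃ c : Fin r → k, g = ∑ s, c s • φ s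

theorem exists_isKoszulBasis (hQ : LocallyFinite Q) (R : TwoSidedIdeal (PathAlgebra k Q)) (a : Q)
    (n : ℕ) : ∃ (r : ℕ) (x : Fin r → Q) (φ : Fin r → PathAlgebra k Q),
      IsKoszulBasis R a n x φ := by
  -- The basis is extracted from the elements that end at a single vertex, so that each one has a
  -- vertex to label its projective summand.
  set H : Set (PathAlgebra k Q) :=
    {g | g ∈ koszulPart R 0 n ∧ g * vtx k a = g ∧ ∃ y, vtx k y * g = g} with hH
  obtain ⟨b, hbH, hbs, hli⟩ := exists_linearIndependent k H
  set V := Submodule.span k ((ofPath k) '' {p : QPath Q | p.source = a ∧ p.length = n}) with hV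
  have : FiniteDimensional k V :=
    FiniteDimensional.span_of_finite k ((finite_paths hQ a n).image _)
  have hHV : H ⊆ V := by
    rintro g ⟨hg, hga, -⟩
    suffices h : degreePart k Q n ≤ V.comap (mulBilin.flip (vtx k a)) by
      rw [← hga]; exact h hg.1
    refine Submodule.span_le.2 ?_
    rintro _ ⟨p, hp, rfl⟩
    change ofPath k p * vtx k a ∈ V
    rw [ofPath_mul_vtx]
    split_ifs with h
    · exact Submodule.subset_span ⟨p, ⟨h, hp⟩, rfl⟩
    · exact Submodule.zero_mem _
  have hfin : Finite b := by
    have hli' : LinearIndependent k (fun g : b => (⟨g.1, hHV (hbH g.2)⟩ : V)) :=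
      LinearIndependent.of_comp V.subtype hli
    exact hli'.finite
  obtain ⟨r, ⟨e⟩⟩ := Finite.exists_equiv_fin b
  choose y hy using fun g : b => (hbH g.2).2.2
  refine ⟨r, fun s => y (e.symm s), fun s => (e.symm s : PathAlgebra k Q),
    fun s => (hbH (e.symm s).2).1, fun s => (hbH (e.symm s).2).2.1, fun s => hy (e.symm s),
    hli.comp _ e.symm.injective, fun g hg hga => ?_⟩
  have hgs : g ∈ Submodule.span k (Set.range fun s => (e.symm s : PathAlgebra k Q)) := by
    have hr : (Set.range fun s => (e.symm s : PathAlgebra k Q)) = b := by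
      ext z
      constructor
      · rintro ⟨s, rfl⟩; exact (e.symm s).2
      · exact fun hz => ⟨e ⟨z, hz⟩, by simp⟩
    rw [hr, hbs]
    obtain ⟨F, hF⟩ := eq_sum_vtx_mul g
    rw [hF]
    refine Submodule.sum_mem _ fun z _ => Submodule.subset_span
      ⟨koszulPart_vtx_mul hg z, by rw [mul_assoc, hga], z, ?_⟩
    rw [← mul_assoc, vtx_mul_self]
  obtain ⟨c, hc⟩ := (Submodule.mem_span_range_iff_exists_fun k).1 hgs
  exact ⟨c, hc.symm⟩

namespace IsKoszulBasis

variable {a : Q} {i j n r : ℕ} {x : Fin r → Q} {φ : Fin r → PathAlgebra k Q}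

/-- If some coefficient were outside `R`, a linear form vanishing on `R` but not on it would turn
the sum into a nontrivial linear relation between the φ_s: each quotient of the sum by a path of
length `j` lies in `R`. -/
theorem mem_of_sum_mem (hφ : IsKoszulBasis R a j x φ) (hn : i + j = n)
    {f : Fin r → PathAlgebra k Q} (hf : ∀ s, f s * vtx k (x s) = f s)
    (h : ∑ s, f s * φ s ∈ idealPart R i n) (s : Fin r) : f s ∈ R := by
  by_contra hs
  obtain ⟨l, hl, hlR⟩ := Submodule.exists_le_ker_of_notMem
    (p := idealSubmodule R) (v := f s) hs
  refine hl (Fintype.linearIndependent_iff.1 hφ.linearIndependent (fun s => l (f s)) ?_ s)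
  refine ext_pair fun q => ?_
  simp only [map_sum, map_smul, LinearMap.sum_apply, LinearMap.smul_apply, smul_eq_mul, map_zero,
    LinearMap.zero_apply]
  by_cases hq : q.length = j
  · have h1 : l (rdiv (ofPath k q) (∑ s, f s * φ s)) = 0 := hlR (h.2 q (by omega))
    rw [map_sum, map_sum] at h1
    rw [← h1]
    refine Finset.sum_congr rfl fun t _ => ?_
    rw [rdiv_mul _ (hφ.mem t).1 hq, map_smul, smul_eq_mul, mul_comm]
    by_cases hqx : q.target = x t
    · rw [hqx, hf]
    · rw [← hφ.vtx_mul t, pair_vtx_mul, vtx_mul_ofPath, if_neg hqx, map_zero, zero_mul, zero_mul]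
  · refine Finset.sum_eq_zero fun t _ => ?_
    rw [mem_degreePart_iff.1 (hφ.mem t).1 q hq, mul_zero]

theorem sum_mem_idealPart (hφ : IsKoszulBasis R a j x φ) (hn : i + j = n)
    {f : Fin r → PathAlgebra k Q} (hf : ∀ s, f s ∈ R) (hfi : ∀ s, f s ∈ degreePart k Q i) :
    ∑ s, f s * φ s ∈ idealPart R i n :=
  Submodule.sum_mem _ fun s _ => mul_mem_idealPart hn (hf s) (hfi s) (hφ.mem s).1

theorem sum_mem_koszulPart (hφ : IsKoszulBasis R a j x φ) (hn : i + j = n)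
    {f : Fin r → PathAlgebra k Q} (hfi : ∀ s, f s ∈ degreePart k Q i) :
    ∑ s, f s * φ s ∈ koszulPart R i n :=
  Submodule.sum_mem _ fun s _ => mul_mem_koszulPart hn (hfi s) (hφ.mem s)

/-- The quotients of `g` by its left factors of length `i` lie in K_j e_a; expanding them in the
basis and collecting terms gives the coefficients. -/
theorem exists_eq_sum (hφ : IsKoszulBasis R a j x φ) (hn : i + j = n) {g : PathAlgebra k Q}
    (hg : g ∈ koszulPart R i n) (hga : g * vtx k a = g) :
    ∃ f : Fin r → PathAlgebra k Q, (∀ s, f s ∈ degreePart k Q i) ∧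
      (∀ s, f s * vtx k (x s) = f s) ∧ g = ∑ s, f s * φ s := by
  obtain ⟨F, hF, hgF⟩ := exists_eq_sum_ldiv (i := i) (j := j) (f := g) (hn ▸ hg.1)
  have hc : ∀ p : QPath Q, p ∈ F → ∃ c : Fin r → k, ldiv (ofPath k p) g = ∑ s, c s • φ s :=
    fun p hp => hφ.span _ (ldiv_mem_koszulPart hn hg (hF p hp)) (by
      rw [← rdiv_vtx, ← ldiv_rdiv, rdiv_vtx, hga])
  choose! c hc using hc
  refine ⟨fun s => ∑ p ∈ F, c p s • (ofPath k p * vtx k (x s)), fun s => ?_, fun s => ?_, ?_⟩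
  · exact Submodule.sum_mem _ fun p hp => Submodule.smul_mem _ _
      (mul_vtx_mem (ofPath_mem_degreePart (hF p hp)) _)
  · simp only [Finset.sum_mul, smul_mul_assoc, mul_assoc, vtx_mul_self]
  · conv_lhs => rw [hgF]
    simp only [Finset.sum_mul, smul_mul_assoc, mul_assoc, hφ.vtx_mul]
    rw [Finset.sum_comm]
    refine Finset.sum_congr rfl fun p hp => ?_
    rw [hc p hp, Finset.mul_sum]
    simp only [mul_smul_comm]

end IsKoszulBasis

/-! ### Matrices of linear elements -/

/-- The matrix `l` consists of combinations of arrows, from `y s` to `x t` at the place `(t, s)`. -/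
structure IsLinearMatrix {m n : ℕ} (x : Fin m → Q) (y : Fin n → Q)
    (l : Fin m → Fin n → PathAlgebra k Q) : Prop where
  mem : ∀ t s, l t s ∈ degreePart k Q 1
  vtx_mul : ∀ t s, vtx k (x t) * l t s = l t s
  mul_vtx : ∀ t s, l t s * vtx k (y s) = l t s

/-- The product of a row and a matrix. -/
def rowMul {m n : ℕ} (f : Fin m → PathAlgebra k Q) (l : Fin m → Fin n → PathAlgebra k Q) :
    Fin n → PathAlgebra k Q := fun s => ∑ t, f t * l t s

section

variable {m n r : ℕ} {x : Fin m → Q} {y : Fin n → Q} {l : Fin m → Fin n → PathAlgebra k Q}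

theorem IsLinearMatrix.rowMul_mul_vtx (hl : IsLinearMatrix x y l) (f : Fin m → PathAlgebra k Q)
    (s : Fin n) : rowMul f l s * vtx k (y s) = rowMul f l s := by
  simp only [rowMul, Finset.sum_mul, mul_assoc, hl.mul_vtx]

theorem IsLinearMatrix.rowMul_mem (hl : IsLinearMatrix x y l) {f : Fin m → PathAlgebra k Q}
    {i : ℕ} (hf : ∀ t, f t ∈ degreePart k Q i) (s : Fin n) :
    rowMul f l s ∈ degreePart k Q (i + 1) :=
  Submodule.sum_mem _ fun t _ => mul_mem_degreePart (hf t) (hl.mem t s)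

theorem IsLinearMatrix.proj_rowMul (hl : IsLinearMatrix x y l) (f : Fin m → PathAlgebra k Q)
    (i : ℕ) (s : Fin n) :
    proj (i + 1) (rowMul f l s) = rowMul (fun t => proj i (f t)) l s := by
  simp only [rowMul, map_sum, proj_mul _ (hl.mem _ _)]

theorem IsLinearMatrix.proj_zero_rowMul (hl : IsLinearMatrix x y l)
    (f : Fin m → PathAlgebra k Q) (s : Fin n) : proj 0 (rowMul f l s) = 0 := by
  simp only [rowMul, map_sum, proj_mul_of_lt zero_lt_one _ (hl.mem _ _), Finset.sum_const_zero]

theorem sum_rowMul_mul (f : Fin m → PathAlgebra k Q) (φ : Fin n → PathAlgebra k Q) :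
    ∑ s, rowMul f l s * φ s = ∑ t, f t * ∑ s, l t s * φ s := by
  simp only [rowMul, Finset.sum_mul, Finset.mul_sum, mul_assoc]
  exact Finset.sum_comm

theorem rowMul_rowMul (f : Fin m → PathAlgebra k Q) (l' : Fin n → Fin r → PathAlgebra k Q) :
    rowMul (rowMul f l) l' = rowMul f fun t => rowMul (l t) l' := by
  funext s
  exact sum_rowMul_mul f _

end

end

end BoundQuiver

namespace BoundQuiver

noncomputable section

open Classical PathAlgebra QuotientAlgebra

variable {k : Type w} [Field k] {Q : Type u} [Quiver.{v} Q]
  (R : TwoSidedIdeal (PathAlgebra k Q))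

/-! ### Elements of modules and their lifts to `kQ` -/

theorem mk_eq_zero {f : PathAlgebra k Q} : mk R f = 0 ↔ f ∈ R := by
  rw [← mk_zero, mk_eq_mk, sub_zero]

theorem mk_sum {ι : Type*} (s : Finset ι) (f : ι → PathAlgebra k Q) :
    mk R (∑ i ∈ s, f i) = ∑ i ∈ s, mk R (f i) := by
  induction s using Finset.induction_on with
  | empty => rfl
  | insert i s hi ih => rw [Finset.sum_insert hi, Finset.sum_insert hi, mk_add, ih]

theorem inr_smul_def (a b : QuotientAlgebra R) : (Unitization.inr a : Unital R) • b = a * b := by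
  rw [unital_smul_def]
  simp

/-- The element of `P_{x_1} ⊕ ⋯ ⊕ P_{x_n}` given by elements of `kQ`. -/
def lift {n : ℕ} (x : Fin n → Q) (f : Fin n → PathAlgebra k Q) : ProjSum R x :=
  fun s => ⟨mk R (f s * vtx k (x s)), mk R (f s), rfl⟩

section

variable {n : ℕ} {x : Fin n → Q}

theorem coe_lift (f : Fin n → PathAlgebra k Q) (s : Fin n) :
    (lift R x f s : QuotientAlgebra R) = mk R (f s * vtx k (x s)) := rfl

theorem exists_eq_mk_of_mem_projModule {y : Q} {a : QuotientAlgebra R} (ha : a ∈ projModule R y) :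
    ∃ f : PathAlgebra k Q, f * vtx k y = f ∧ a = mk R f := by
  obtain ⟨b, rfl⟩ := ha
  obtain ⟨f, rfl⟩ := mk_surjective R b
  exact ⟨f * vtx k y, by rw [mul_assoc, vtx_mul_self], rfl⟩

/-- Lifts are normalized to start at the vertices of the summands; then congruence of two rows
modulo `R` is equality of their classes. -/
theorem exists_eq_lift (m : ProjSum R x) :
    ∃ f : Fin n → PathAlgebra k Q, (∀ s, f s * vtx k (x s) = f s) ∧ m = lift R x f := by
  choose f hf hm using fun s => exists_eq_mk_of_mem_projModule R (m s).2
  refine ⟨f, hf, funext fun s => Subtype.ext ?_⟩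
  rw [coe_lift, hf, hm]

theorem exists_eq_lift_of_homogeneous {d : ℕ} {m : ProjSum R x}
    (hm : IsHomogeneousElement R d m) :
    ∃ f : Fin n → PathAlgebra k Q, (∀ s, f s * vtx k (x s) = f s) ∧
      (∀ s, f s ∈ degreePart k Q d) ∧ m = lift R x f := by
  obtain ⟨g, hg, rfl⟩ := exists_eq_lift R m
  choose f hf hfg using hm
  refine ⟨fun s => f s * vtx k (x s), fun s => by rw [mul_assoc, vtx_mul_self],
    fun s => mul_vtx_mem (hf s) _, funext fun s => Subtype.ext ?_⟩
  have h := hfg s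
  rw [coe_lift, hg] at h
  rw [coe_lift, coe_lift, mul_assoc, vtx_mul_self, mk_mul, mk_mul, h]

theorem isHomogeneousElement_lift {d : ℕ} {f : Fin n → PathAlgebra k Q}
    (hf : ∀ s, f s ∈ degreePart k Q d) : IsHomogeneousElement R d (lift R x f) :=
  fun s => ⟨_, mul_vtx_mem (hf s) _, rfl⟩

theorem lift_eq_lift_iff {f g : Fin n → PathAlgebra k Q} :
    lift R x f = lift R x g ↔ ∀ s, (f s - g s) * vtx k (x s) ∈ R := by
  rw [funext_iff]
  refine forall_congr' fun s => ?_
  rw [Subtype.ext_iff, coe_lift, coe_lift, mk_eq_mk, sub_mul]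

theorem lift_eq_lift_of_sub_mem {f g : Fin n → PathAlgebra k Q} (h : ∀ s, f s - g s ∈ R) :
    lift R x f = lift R x g :=
  (lift_eq_lift_iff R).2 fun s => R.mul_mem_right _ _ (h s)

theorem lift_zero : lift R x 0 = 0 :=
  funext fun s => Subtype.ext (by rw [coe_lift, Pi.zero_apply, zero_mul]; rfl)

theorem lift_eq_zero_iff {f : Fin n → PathAlgebra k Q} :
    lift R x f = 0 ↔ ∀ s, f s * vtx k (x s) ∈ R := by
  rw [← lift_zero, lift_eq_lift_iff]
  simp only [Pi.zero_apply, sub_zero]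

/-- The generators of `P_{x_1} ⊕ ⋯ ⊕ P_{x_n}`. -/
def gen (x : Fin n → Q) (t : Fin n) : ProjSum R x := lift R x (Pi.single t (vtx k (x t)))

theorem lift_eq_sum_gen (f : Fin n → PathAlgebra k Q) :
    lift R x f = ∑ t, (Unitization.inr (mk R (f t)) : Unital R) • gen R x t := by
  funext s
  refine Subtype.ext ?_
  rw [Finset.sum_apply, Finset.sum_eq_single s]
  · rw [Pi.smul_apply, Submodule.coe_smul, inr_smul_def, coe_lift, gen, coe_lift,
      Pi.single_eq_same, vtx_mul_self, mk_mul]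
  · intro t _ ht
    rw [Pi.smul_apply]
    refine Subtype.ext ?_
    rw [Submodule.coe_smul, inr_smul_def, gen, coe_lift, Pi.single_eq_of_ne ht.symm, zero_mul,
      mk_zero, mul_zero]
    rfl
  · exact fun h => absurd (Finset.mem_univ s) h

/-! ### The radical -/

/-- The classes of the elements of `kQ` with no component in degree zero. -/
def IsPositive (a : QuotientAlgebra R) : Prop := ∃ f : PathAlgebra k Q, proj 0 f = 0 ∧ a = mk R f

-- Positivity does not depend on the representative, because a quadratic ideal has no part of degree
-- zero.
variable {R} in
theorem isPositive_mk_iff (hR : IsQuadratic R) {f : PathAlgebra k Q} :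
    IsPositive R (mk R f) ↔ proj 0 f = 0 := by
  refine ⟨fun ⟨g, hg, h⟩ => ?_, fun h => ⟨f, h, rfl⟩⟩
  have := hR.proj_eq_zero ((mk_eq_mk R).1 h) zero_lt_two
  rwa [map_sub, hg, sub_zero] at this

theorem isPositive_zero : IsPositive R 0 := ⟨0, map_zero _, rfl⟩

theorem IsPositive.add {a b : QuotientAlgebra R} (ha : IsPositive R a) (hb : IsPositive R b) :
    IsPositive R (a + b) := by
  obtain ⟨f, hf, rfl⟩ := ha
  obtain ⟨g, hg, rfl⟩ := hb
  exact ⟨f + g, by rw [map_add, hf, hg, add_zero], rfl⟩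

theorem IsPositive.smul {a : QuotientAlgebra R} (c : k) (ha : IsPositive R a) :
    IsPositive R (c • a) := by
  obtain ⟨f, hf, rfl⟩ := ha
  exact ⟨c • f, by rw [map_smul, hf, smul_zero], rfl⟩

theorem IsPositive.mul_left {a : QuotientAlgebra R} (b : QuotientAlgebra R)
    (ha : IsPositive R a) : IsPositive R (b * a) := by
  obtain ⟨f, hf, rfl⟩ := ha
  obtain ⟨g, rfl⟩ := mk_surjective R b
  exact ⟨g * f, by rw [proj_zero_mul, hf, mul_zero], rfl⟩

theorem IsPositive.mul_right {a : QuotientAlgebra R} (b : QuotientAlgebra R)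
    (ha : IsPositive R a) : IsPositive R (a * b) := by
  obtain ⟨f, hf, rfl⟩ := ha
  obtain ⟨g, rfl⟩ := mk_surjective R b
  exact ⟨f * g, by rw [proj_zero_mul, hf, zero_mul], rfl⟩

theorem IsPositive.unital_smul {a : QuotientAlgebra R} (r : Unital R) (ha : IsPositive R a) :
    IsPositive R (r • a) := by
  rw [unital_smul_def]
  exact (ha.smul R _).add R (ha.mul_left R _)

theorem isPositive_of_mem_arrowIdeal {a : QuotientAlgebra R} (ha : a ∈ arrowIdeal R) :
    IsPositive R a := by
  induction ha using TwoSidedIdeal.span_induction with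
  | mem a ha =>
    obtain ⟨x, y, α, rfl⟩ := ha
    exact ⟨_, by rw [proj_ofPath, if_neg]; exact one_ne_zero, rfl⟩
  | zero => exact isPositive_zero R
  | add a b _ _ ha hb => exact ha.add R hb
  | neg a _ ha => simpa using ha.smul R (-1)
  | left_absorb b a _ ha => exact ha.mul_left R b
  | right_absorb b a _ ha => exact ha.mul_right R b

/-- A path of positive length has its first arrow as a right factor. -/
theorem mem_arrowIdeal {a : QuotientAlgebra R} (ha : IsPositive R a) : a ∈ arrowIdeal R := by
  obtain ⟨f, hf, rfl⟩ := ha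
  rw [eq_sum_coeff f, mk_sum]
  refine sum_mem fun p hp => ?_
  have hl : p.length ≠ 0 := by
    intro hl
    have h : pair (proj 0 f) (ofPath k p) = 0 := by rw [hf, map_zero, LinearMap.zero_apply]
    rw [pair_proj, proj_ofPath, if_pos hl, pair_ofPath_right] at h
    simp [h] at hp
  obtain ⟨s, ⟨q₁, q₂, q⟩, hc, rfl, -, hq⟩ := p.exists_comp_eq (i := p.length - 1) (j := 1)
    (by omega)
  rw [show ofPath k (s.comp ⟨q₁, q₂, q⟩ hc) = ofPath k s * ofPath k ⟨q₁, q₂, q⟩ by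
    rw [ofPath_mul_ofPath, pathMul, dif_pos hc], ← smul_mul_assoc, mk_mul]
  refine (arrowIdeal R).mul_mem_left _ _ (TwoSidedIdeal.subset_span ?_)
  cases q with
  | nil => simp [QPath.length] at hq
  | @cons b _ q α =>
    have hq0 : q.length = 0 := by simpa [QPath.length] using hq
    obtain rfl := Quiver.Path.eq_of_length_zero q hq0
    obtain rfl := Quiver.Path.eq_nil_of_length_zero q hq0
    exact ⟨_, _, α, rfl⟩

theorem isPositive_of_mem_radical {m : ProjSum R x} (hm : m ∈ radical R (ProjSum R x))
    (s : Fin n) : IsPositive R (m s : QuotientAlgebra R) := by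
  induction hm using Submodule.span_induction with
  | mem m hm =>
    obtain ⟨j, hj, m', rfl⟩ := hm
    rw [Pi.smul_apply, Submodule.coe_smul, inr_smul_def]
    exact (isPositive_of_mem_arrowIdeal R hj).mul_right R _
  | zero => exact isPositive_zero R
  | add a b _ _ ha hb => exact ha.add R hb
  | smul r a _ ha => exact ha.unital_smul R r

theorem lift_mem_radical {f : Fin n → PathAlgebra k Q} (hf : ∀ s, proj 0 (f s) = 0) :
    lift R x f ∈ radical R (ProjSum R x) := by
  rw [lift_eq_sum_gen]
  exact Submodule.sum_mem _ fun t _ => Submodule.subset_span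
    ⟨_, mem_arrowIdeal R ⟨_, hf t, rfl⟩, _, rfl⟩

theorem mem_radical_projModule_iff {a : Q} {m : projModule R a} :
    m ∈ radical R (projModule R a) ↔ IsPositive R (m : QuotientAlgebra R) := by
  constructor
  · intro hm
    induction hm using Submodule.span_induction with
    | mem m hm =>
      obtain ⟨j, hj, m', rfl⟩ := hm
      rw [Submodule.coe_smul, inr_smul_def]
      exact (isPositive_of_mem_arrowIdeal R hj).mul_right R _
    | zero => exact isPositive_zero R
    | add a b _ _ ha hb => exact ha.add R hb
    | smul r a _ ha => exact ha.unital_smul R r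
  · intro hm
    obtain ⟨f, hf, h⟩ := exists_eq_mk_of_mem_projModule R m.2
    -- The element is itself a member of J, acting on the generator e_a.
    refine Submodule.subset_span ⟨m, mem_arrowIdeal R hm, ⟨idem R a, mk R (vtx k a), ?_⟩,
      Subtype.ext ?_⟩
    · change mk R (vtx k a) = mk R (vtx k a * vtx k a)
      rw [vtx_mul_self]
    · rw [Submodule.coe_smul, inr_smul_def, h]
      change mk R f = mk R (f * vtx k a)
      rw [hf]

end

/-! ### Right multiplication by a matrix -/

section

variable {m n : ℕ} (x : Fin m → Q) (y : Fin n → Q)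

/-- The map given by right multiplication by a matrix. -/
def mulMatrix (l : Fin m → Fin n → PathAlgebra k Q) : ProjSum R x →ₗ[Unital R] ProjSum R y where
  toFun a := fun s => ⟨∑ t, (a t : QuotientAlgebra R) * mk R (l t s * vtx k (y s)),
    ∑ t, (a t : QuotientAlgebra R) * mk R (l t s), by
      rw [Finset.sum_mul]
      refine Finset.sum_congr rfl fun t _ => ?_
      rw [mul_assoc]
      rfl⟩
  map_add' a b := by
    funext s
    refine Subtype.ext ?_
    simp only [Pi.add_apply, Submodule.coe_add, add_mul, Finset.sum_add_distrib]
  map_smul' r a := by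
    funext s
    refine Subtype.ext ?_
    simp only [Pi.smul_apply, Submodule.coe_smul, RingHom.id_apply, unital_smul_def, add_mul,
      smul_mul_assoc, mul_assoc, Finset.sum_add_distrib, Finset.smul_sum]

variable {x y} {l : Fin m → Fin n → PathAlgebra k Q}

theorem mulMatrix_lift (hl : IsLinearMatrix x y l) (f : Fin m → PathAlgebra k Q) :
    mulMatrix R x y l (lift R x f) = lift R y (rowMul f l) := by
  funext s
  refine Subtype.ext ?_
  rw [coe_lift, hl.rowMul_mul_vtx, rowMul, mk_sum]
  change ∑ t, (lift R x f t : QuotientAlgebra R) * mk R (l t s * vtx k (y s)) = _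
  refine Finset.sum_congr rfl fun t _ => ?_
  rw [coe_lift, ← mk_mul, mul_assoc, ← mul_assoc (vtx k (x t)), hl.vtx_mul, hl.mul_vtx]

/-- The images of the generators, which have degree zero, are rows of linear elements, and they
determine the map. -/
theorem exists_isLinearMatrix (d : ProjSum R x →ₗ[Unital R] ProjSum R y)
    (hd : ∀ (i : ℕ) (a : ProjSum R x), IsHomogeneousElement R i a →
      IsHomogeneousElement R (i + 1) (d a)) :
    ∃ l : Fin m → Fin n → PathAlgebra k Q, IsLinearMatrix x y l ∧
      ∀ f, d (lift R x f) = lift R y (rowMul f l) := by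
  have h1 : ∀ t, IsHomogeneousElement R 0 (gen R x t) := fun t =>
    isHomogeneousElement_lift R fun s => by
      by_cases h : s = t
      · subst h; rw [Pi.single_eq_same]; exact vtx_mem _
      · rw [Pi.single_eq_of_ne h]; exact zero_mem _
  choose l hl1 hl2 hl3 using fun t => exists_eq_lift_of_homogeneous R (hd 0 _ (h1 t))
  -- Multiplying a row by its vertex does not change the map, as the generator is fixed by this
  -- vertex (`h2`).
  have hl : IsLinearMatrix x y fun t s => vtx k (x t) * l t s :=
    ⟨fun t s => vtx_mul_mem (hl2 t s) _, fun t s => by rw [← mul_assoc, vtx_mul_self],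
      fun t s => by rw [mul_assoc, hl1]⟩
  refine ⟨_, hl, fun f => ?_⟩
  have h2 : ∀ t, gen R x t = (Unitization.inr (idem R (x t)) : Unital R) • gen R x t := by
    intro t
    funext s
    refine Subtype.ext ?_
    rw [Pi.smul_apply, Submodule.coe_smul, inr_smul_def, gen, coe_lift]
    change _ = mk R (vtx k (x t) * _)
    by_cases h : s = t
    · subst h
      rw [Pi.single_eq_same, vtx_mul_self, vtx_mul_self]
    · rw [Pi.single_eq_of_ne h, zero_mul, mul_zero]
  rw [lift_eq_sum_gen, map_sum]
  funext s
  refine Subtype.ext ?_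
  rw [coe_lift, hl.rowMul_mul_vtx, rowMul, mk_sum, Finset.sum_apply, Submodule.coe_sum]
  refine Finset.sum_congr rfl fun t _ => ?_
  rw [map_smul, h2 t, map_smul, hl3, Pi.smul_apply, Pi.smul_apply, Submodule.coe_smul,
    Submodule.coe_smul, inr_smul_def, inr_smul_def, coe_lift, hl1]
  rfl

end

end

end BoundQuiver

namespace BoundQuiver

noncomputable section

open Classical PathAlgebra QuotientAlgebra

variable {k : Type w} [Field k] {Q : Type u} [Quiver.{v} Q]
  {R : TwoSidedIdeal (PathAlgebra k Q)}

theorem vtx_ne_zero (x : Q) : vtx k x ≠ 0 := fun h => by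
  have : pair (vtx k x) (vtx k x) = 0 := by rw [h, map_zero]
  rw [vtx, pair_ofPath_ofPath, if_pos rfl] at this
  exact one_ne_zero this

/-! ### The simple modules -/

variable (R) in
/-- The class of `h e_a` in `P_a`, for an element `h` of `kQ`. -/
def projClass (a : Q) (h : PathAlgebra k Q) : projModule R a :=
  ⟨mk R (h * vtx k a), mk R h, rfl⟩

theorem coe_projClass (a : Q) (h : PathAlgebra k Q) :
    (projClass R a h : QuotientAlgebra R) = mk R (h * vtx k a) := rfl

variable (R) in
/-- The class in `S_a` of an element of `kQ`. -/
def simpleClass (a : Q) (h : PathAlgebra k Q) : simpleModule R a :=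
  (radical R (projModule R a)).mkQ (projClass R a h)

section

variable {a : Q}

/-- Only the component of degree zero survives modulo J e_a, and `R` has none. -/
theorem simpleClass_eq_iff (hR : IsQuadratic R) {f g : PathAlgebra k Q} :
    simpleClass R a f = simpleClass R a g ↔ proj 0 (f * vtx k a) = proj 0 (g * vtx k a) := by
  rw [simpleClass, simpleClass, ← sub_eq_zero, ← map_sub, Submodule.mkQ_apply,
    Submodule.Quotient.mk_eq_zero, mem_radical_projModule_iff]
  change IsPositive R (mk R (f * vtx k a - g * vtx k a)) ↔ _
  rw [isPositive_mk_iff hR, map_sub, sub_eq_zero]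

theorem simpleClass_zero : simpleClass R a 0 = 0 := by
  have : projClass R a 0 = 0 := Subtype.ext (by rw [coe_projClass, zero_mul]; rfl)
  rw [simpleClass, this, map_zero]

theorem simpleClass_add (f g : PathAlgebra k Q) :
    simpleClass R a (f + g) = simpleClass R a f + simpleClass R a g := by
  rw [simpleClass, simpleClass, simpleClass, ← map_add]
  congr 1
  refine Subtype.ext ?_
  change mk R ((f + g) * vtx k a) = mk R (f * vtx k a + g * vtx k a)
  rw [add_mul]

theorem simpleClass_sum {ι : Type*} (s : Finset ι) (f : ι → PathAlgebra k Q) :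
    simpleClass R a (∑ i ∈ s, f i) = ∑ i ∈ s, simpleClass R a (f i) := by
  induction s using Finset.induction_on with
  | empty => exact simpleClass_zero
  | insert i s hi ih => rw [Finset.sum_insert hi, Finset.sum_insert hi, simpleClass_add, ih]

theorem inr_smul_simpleClass (f g : PathAlgebra k Q) :
    (Unitization.inr (mk R f) : Unital R) • simpleClass R a g = simpleClass R a (f * g) := by
  rw [simpleClass, simpleClass, ← map_smul]
  congr 1
  refine Subtype.ext ?_
  rw [Submodule.coe_smul, inr_smul_def, coe_projClass, coe_projClass, ← mk_mul, mul_assoc]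

theorem exists_eq_simpleClass (m : simpleModule R a) :
    ∃ f : PathAlgebra k Q, f * vtx k a = f ∧ m = simpleClass R a f := by
  obtain ⟨b, rfl⟩ := Submodule.mkQ_surjective _ m
  obtain ⟨f, hf, h⟩ := exists_eq_mk_of_mem_projModule R b.2
  refine ⟨f, hf, ?_⟩
  rw [simpleClass]
  congr 1
  exact Subtype.ext (by rw [h, coe_projClass, hf])

theorem exists_aug_eq {r : ℕ} {x : Fin r → Q} (aug : ProjSum R x →ₗ[Unital R] simpleModule R a) :
    ∃ g : Fin r → PathAlgebra k Q, (∀ s, g s * vtx k a = g s) ∧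
      ∀ f, aug (lift R x f) = simpleClass R a (∑ s, f s * g s) := by
  choose g hg h using fun s => exists_eq_simpleClass (aug (gen R x s))
  refine ⟨g, hg, fun f => ?_⟩
  rw [lift_eq_sum_gen, map_sum, simpleClass_sum]
  refine Finset.sum_congr rfl fun s _ => ?_
  rw [map_smul, h, inr_smul_simpleClass]

end

/-! ### Exactness of the Koszul complexes from linear resolutions -/

section

variable {a : Q} {i j r m : ℕ} {x : Fin r → Q} {z : Fin m → Q} {φ : Fin r → PathAlgebra k Q}
  {l : Fin m → Fin r → PathAlgebra k Q}

/-- Since `R` is graded, a preimage of a homogeneous row may be replaced by its component of one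
degree less. -/
theorem IsLinearMatrix.sub_rowMul_mem (hR : IsQuadratic R) (hl : IsLinearMatrix z x l)
    {f : Fin r → PathAlgebra k Q} {f' : Fin m → PathAlgebra k Q}
    (hf : ∀ s, f s ∈ degreePart k Q (i + 1)) (hfx : ∀ s, f s * vtx k (x s) = f s)
    (h : lift R x f = lift R x (rowMul f' l)) (s : Fin r) :
    f s - rowMul (fun t => proj i (f' t)) l s ∈ R := by
  have h1 := (lift_eq_lift_iff R).1 h s
  rw [sub_mul, hfx, hl.rowMul_mul_vtx] at h1
  have h2 := hR.proj_mem h1 (i + 1)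
  rwa [map_sub, proj_eq_self (hf s), hl.proj_rowMul] at h2

/-- Here `h1` is exactness in degree one, `h2` says that the products lie in K_{j+1}, and `h3` is
minimality. A linear relation between the products gives a row of scalar multiples of vertices in
the kernel, which minimality kills; this is independence. For spanning, an element of K_{j+1} e_a
has a row of degree one in the old basis, and exactness lifts it to a row whose degree zero part
gives the scalars. -/
theorem IsKoszulBasis.succ (hR : IsQuadratic R) (hφ : IsKoszulBasis R a j x φ)
    (hl : IsLinearMatrix z x l)
    (h1 : ∀ f : Fin r → PathAlgebra k Q, (∀ s, f s ∈ degreePart k Q 1) →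
      (∀ s, f s * vtx k (x s) = f s) → ∑ s, f s * φ s ∈ koszulPart R 0 (j + 1) →
      ∃ f', lift R x f = lift R x (rowMul f' l))
    (h2 : ∀ t, ∑ s, l t s * φ s ∈ koszulPart R 0 (j + 1))
    (h3 : ∀ f', lift R x (rowMul f' l) = 0 → ∀ t, proj 0 (f' t * vtx k (z t)) = 0) :
    IsKoszulBasis R a (j + 1) z fun t => ∑ s, l t s * φ s := by
  have hz : ∀ t, vtx k (z t) * ∑ s, l t s * φ s = ∑ s, l t s * φ s := fun t => by
    simp only [Finset.mul_sum, ← mul_assoc, hl.vtx_mul]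
  refine ⟨h2, fun t => ?_, hz, ?_, fun g hg hga => ?_⟩
  · simp only [Finset.sum_mul, mul_assoc, hφ.mul_vtx]
  · refine Fintype.linearIndependent_iff.2 fun c hc t => ?_
    have h4 : ∑ s, rowMul (fun t => c t • vtx k (z t)) l s * φ s ∈ idealPart R 1 (j + 1) := by
      rw [sum_rowMul_mul]
      simp only [smul_mul_assoc, hz, hc]
      exact zero_mem _
    have h5 := hφ.mem_of_sum_mem (add_comm 1 j) (hl.rowMul_mul_vtx _) h4
    have h6 := h3 _ ((lift_eq_zero_iff R).2 fun s => R.mul_mem_right _ _ (h5 s)) t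
    rw [smul_mul_assoc, vtx_mul_self, map_smul, proj_eq_self (vtx_mem _)] at h6
    exact (smul_eq_zero.1 h6).resolve_right (vtx_ne_zero _)
  · obtain ⟨f, hf, hfx, rfl⟩ := hφ.exists_eq_sum (add_comm 1 j)
      (koszulPart_mono (Nat.zero_le 1) hg) hga
    obtain ⟨f', hf'⟩ := h1 f hf hfx hg
    -- The congruence modulo `R` is an equality because both sides have degree one and R_1 = 0.
    have h4 : ∀ s, f s = rowMul (fun t => proj 0 (f' t)) l s := fun s =>
      sub_eq_zero.1 (hR.eq_zero (hl.sub_rowMul_mem (i := 0) hR hf hfx hf' s) one_lt_two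
        (sub_mem (hf s) (hl.rowMul_mem (fun t => proj_mem 0 _) s)))
    choose c hc using fun t => exists_smul_vtx (proj_mem 0 (f' t)) (z t)
    refine ⟨c, ?_⟩
    simp only [h4]
    rw [sum_rowMul_mul]
    refine Finset.sum_congr rfl fun t _ => ?_
    rw [← hz t, ← mul_assoc, hc, smul_mul_assoc]

end

theorem proj_eq_zero_of_lift_mem_radical (hR : IsQuadratic R) {r : ℕ} {x : Fin r → Q}
    {f : Fin r → PathAlgebra k Q} (hf : lift R x f ∈ radical R (ProjSum R x)) (s : Fin r) :
    proj 0 (f s * vtx k (x s)) = 0 :=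
  (isPositive_mk_iff hR).1 (isPositive_of_mem_radical R hf s)

/-- A linear resolution of `S_a` is given by matrices of linear elements, and the products of these
matrices are bases of the spaces `K_n e_a`. -/
theorem LinearProjectiveResolution.exists_isKoszulBasis {a : Q} (hR : IsQuadratic R)
    (res : LinearProjectiveResolution R (simpleModule R a)) :
    ∃ (l : ∀ n, Fin (res.rank (n + 1)) → Fin (res.rank n) → PathAlgebra k Q)
      (φ : ∀ n, Fin (res.rank n) → PathAlgebra k Q),
      (∀ n, IsLinearMatrix (res.vertex (n + 1)) (res.vertex n) (l n)) ∧
      (∀ n f, res.diff n (lift R _ f) = lift R _ (rowMul f (l n))) ∧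
      (∀ n, IsKoszulBasis R a n (res.vertex n) (φ n)) ∧
      ∀ n t, φ (n + 1) t = ∑ s, l n t s * φ n s := by
  choose l hl hd using fun n => exists_isLinearMatrix R (res.diff n) (res.homogeneous n)
  obtain ⟨g, hg, haug⟩ := exists_aug_eq res.aug
  -- The augmentation is not assumed homogeneous, but the simple module sees only the degree zero
  -- part of its values. The later terms are successive products of the matrices.
  let φ : ∀ n, Fin (res.rank n) → PathAlgebra k Q := fun n =>
    Nat.rec (motive := fun n => Fin (res.rank n) → PathAlgebra k Q)
      (fun s => vtx k (res.vertex 0 s) * proj 0 (g s)) (fun n φn t => ∑ s, l n t s * φn s) n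
  have h3 : ∀ n f', lift R _ (rowMul f' (l n)) = 0 →
      ∀ t, proj 0 (f' t * vtx k (res.vertex (n + 1) t)) = 0 := fun n f' hf' =>
    proj_eq_zero_of_lift_mem_radical hR (res.ker_diff_le n (by rw [LinearMap.mem_ker, hd, hf']))
  have haug' : ∀ f : Fin (res.rank 0) → PathAlgebra k Q,
      (∀ s, f s * vtx k (res.vertex 0 s) = f s) →
      ∀ h, res.aug (lift R _ f) = simpleClass R a h ↔
        ∑ s, proj 0 (f s) * φ 0 s = proj 0 (h * vtx k a) := by
    intro f hf h
    rw [haug, simpleClass_eq_iff hR]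
    have : proj 0 ((∑ s, f s * g s) * vtx k a) = ∑ s, proj 0 (f s) * φ 0 s := by
      rw [Finset.sum_mul, map_sum]
      refine Finset.sum_congr rfl fun s _ => ?_
      rw [mul_assoc, hg, proj_zero_mul]
      change _ = proj 0 (f s) * (vtx k (res.vertex 0 s) * proj 0 (g s))
      rw [← mul_assoc, ← proj_mul_vtx, hf]
    rw [this]
  have haug0 : ∀ f : Fin (res.rank 0) → PathAlgebra k Q,
      (∀ s, f s * vtx k (res.vertex 0 s) = f s) →
      (res.aug (lift R _ f) = 0 ↔ ∑ s, proj 0 (f s) * φ 0 s = 0) := by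
    intro f hf
    rw [← simpleClass_zero, haug' f hf, zero_mul, map_zero]
  have hφ0 : IsKoszulBasis R a 0 (res.vertex 0) (φ 0) := by
    have hvm : ∀ s, vtx k (res.vertex 0 s) * φ 0 s = φ 0 s := fun s => by
      change vtx k (res.vertex 0 s) * (vtx k (res.vertex 0 s) * proj 0 (g s)) = _
      rw [← mul_assoc, vtx_mul_self]
      rfl
    refine ⟨fun s => ?_, fun s => ?_, hvm, ?_, fun h hh hha => ?_⟩
    · rw [koszulPart_eq (by omega)]
      exact vtx_mul_mem (proj_mem 0 _) _
    · change vtx k (res.vertex 0 s) * proj 0 (g s) * vtx k a = _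
      rw [mul_assoc, ← proj_mul_vtx, hg]
      rfl
    · refine Fintype.linearIndependent_iff.2 fun c hc t => ?_
      have h1 : res.aug (lift R _ fun s => c s • vtx k (res.vertex 0 s)) = 0 := by
        rw [haug0 _ fun s => by rw [smul_mul_assoc, vtx_mul_self]]
        simpa only [map_smul, proj_eq_self (vtx_mem _), smul_mul_assoc, hvm] using hc
      have h2 := proj_eq_zero_of_lift_mem_radical hR (res.ker_aug_le h1) t
      rw [smul_mul_assoc, vtx_mul_self, map_smul, proj_eq_self (vtx_mem _)] at h2
      exact (smul_eq_zero.1 h2).resolve_right (vtx_ne_zero _)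
    · obtain ⟨b, hb⟩ := res.aug_surjective (simpleClass R a h)
      obtain ⟨f, hf, rfl⟩ := exists_eq_lift R b
      rw [haug' f hf, hha, proj_eq_self hh.1] at hb
      choose c hc using fun s => exists_smul_vtx (proj_mem 0 (f s)) (res.vertex 0 s)
      refine ⟨c, ?_⟩
      rw [← hb]
      refine Finset.sum_congr rfl fun s _ => ?_
      rw [← hvm s, ← mul_assoc, hc, smul_mul_assoc]
  have hφ1 : IsKoszulBasis R a 1 (res.vertex 1) (φ 1) := by
    refine hφ0.succ hR (hl 0) (fun f hf hfx _ => ?_) (fun t => ?_) (h3 0)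
    · have : res.aug (lift R _ f) = 0 := by
        rw [haug0 f hfx]
        exact Finset.sum_eq_zero fun s _ => by rw [proj_eq_zero (hf s) one_ne_zero, zero_mul]
      obtain ⟨b, hb⟩ := (res.exact_zero _).1 this
      obtain ⟨f', -, rfl⟩ := exists_eq_lift R b
      exact ⟨f', by rw [← hb, hd]⟩
    · rw [koszulPart_eq (by omega)]
      refine Submodule.sum_mem _ fun s _ => ?_
      have h := mul_mem_degreePart ((hl 0).mem t s) (hφ0.mem s).1
      rw [add_zero] at h
      exact h
  have hrow : ∀ n f, ∑ t, f t * φ (n + 1) t = ∑ s, rowMul f (l n) s * φ n s := fun n f =>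
    (sum_rowMul_mul f (φ n)).symm
  -- Two consecutive bases are carried along: the new differential is controlled by the previous
  -- one, which is read in the basis before it.
  have hstep : ∀ n, IsKoszulBasis R a n (res.vertex n) (φ n) ∧
      IsKoszulBasis R a (n + 1) (res.vertex (n + 1)) (φ (n + 1)) := by
    intro n
    induction n with
    | zero => exact ⟨hφ0, hφ1⟩
    | succ n ih =>
      obtain ⟨ih0, ih1⟩ := ih
      refine ⟨ih1, ih1.succ hR (hl (n + 1)) (fun f hf hfx hm => ?_) (fun t => ?_) (h3 (n + 1))⟩
      -- An element of K_{n+2} lies in R_2 kQ_n, so its row is sent into `R` by the previous matrix.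
      -- It is a cycle, hence a boundary.
      · have h4 := koszulPart_zero_le_idealPart _ hm
        rw [hrow] at h4
        have h5 := ih0.mem_of_sum_mem (by omega) ((hl n).rowMul_mul_vtx _) h4
        have h6 : res.diff n (lift R _ f) = 0 := by
          rw [hd, lift_eq_zero_iff]
          exact fun s => R.mul_mem_right _ _ (h5 s)
        obtain ⟨b, hb⟩ := (res.exact_succ n _).1 h6
        obtain ⟨f', -, rfl⟩ := exists_eq_lift R b
        exact ⟨f', by rw [← hb, hd]⟩
      -- Membership in kQ_1 K_{n+1} is clear; membership in R_2 kQ_n expresses that two consecutive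
      -- differentials compose to zero on a generator.
      · refine koszulPart_one_inf_le _ ⟨ih1.sum_mem_koszulPart (by omega)
          ((hl (n + 1)).mem t), ?_⟩
        rw [hrow]
        refine ih0.sum_mem_idealPart (by omega) (fun s => ?_) ((hl n).rowMul_mem
          ((hl (n + 1)).mem t))
        have h4 : res.diff n (res.diff (n + 1) (lift R _
            (Pi.single t (vtx k (res.vertex (n + 2) t))))) = 0 :=
          (res.exact_succ n _).2 ⟨_, rfl⟩
        rw [hd, hd, lift_eq_zero_iff] at h4
        have h5 := h4 s
        rw [(hl n).rowMul_mul_vtx] at h5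
        convert! h5 using 2
        funext s'
        rw [rowMul, Finset.sum_eq_single t]
        · rw [Pi.single_eq_same, (hl (n + 1)).vtx_mul]
        · intro t' _ ht'
          rw [Pi.single_eq_of_ne ht', zero_mul]
        · exact fun h => absurd (Finset.mem_univ t) h
  exact ⟨l, φ, hl, hd, fun n => (hstep n).1, fun n t => rfl⟩

/-- On the component at `a`, the resolution of S_a is the Koszul complex: membership in B_{i+2}
makes the row of coefficients a cycle, and writing it as a boundary modulo `R` splits the element as
required. -/
theorem IsKoszul.koszulExact (hR : IsQuadratic R) (h : IsKoszul R) : KoszulExact R := by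
  intro n i hi g hg
  obtain ⟨j, rfl⟩ : ∃ j, n = i + 1 + (j + 1) := ⟨n - (i + 2), by omega⟩
  obtain ⟨F, hF⟩ := eq_sum_mul_vtx g
  rw [hF]
  refine Submodule.sum_mem _ fun a _ => ?_
  have hga : g * vtx k a * vtx k a = g * vtx k a := by rw [mul_assoc, vtx_mul_self]
  have hg1 := koszulPart_mul_vtx hg.1 a
  have hg2 := idealPart_mul_vtx hg.2 a
  generalize g * vtx k a = g' at hga hg1 hg2
  obtain ⟨res⟩ := h a
  obtain ⟨l, φ, hl, hd, hφ, hφs⟩ := LinearProjectiveResolution.exists_isKoszulBasis hR res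
  have hrow : ∀ n f, ∑ t, f t * φ (n + 1) t = ∑ s, rowMul f (l n) s * φ n s := fun n f => by
    simp only [hφs, sum_rowMul_mul f (φ n)]
  obtain ⟨f, hf, hfx, rfl⟩ := (hφ (j + 1)).exists_eq_sum rfl hg1 hga
  rw [hrow] at hg2
  have h5 := (hφ j).mem_of_sum_mem (by omega) ((hl j).rowMul_mul_vtx _) hg2
  have h6 : res.diff j (lift R _ f) = 0 := by
    rw [hd, lift_eq_zero_iff]
    exact fun s => R.mul_mem_right _ _ (h5 s)
  obtain ⟨b, hb⟩ := (res.exact_succ j _).1 h6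
  obtain ⟨f', -, rfl⟩ := exists_eq_lift R b
  rw [hd] at hb
  have h7 := (hl (j + 1)).sub_rowMul_mem hR hf hfx hb.symm
  -- The first sum has coefficients in R_{i+1}, so it lies in B_{i+1}; the second lies in kQ_i
  -- K_{j+2}, that is, in A_i.
  have h8 : ∑ s, f s * φ (j + 1) s =
      ∑ s, (f s - rowMul (fun t => proj i (f' t)) (l (j + 1)) s) * φ (j + 1) s +
        ∑ t, proj i (f' t) * φ (j + 1 + 1) t := by
    rw [hrow (j + 1), ← Finset.sum_add_distrib]
    simp only [sub_mul, sub_add_cancel]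
  rw [h8]
  exact Submodule.add_mem_sup
    ((hφ (j + 1)).sum_mem_idealPart rfl h7
      fun s => sub_mem (hf s) ((hl (j + 1)).rowMul_mem (fun t => proj_mem i _) s))
    ((hφ (j + 1 + 1)).sum_mem_koszulPart (by omega) fun t => proj_mem i _)

end

end BoundQuiver

namespace BoundQuiver

noncomputable section

open Classical PathAlgebra QuotientAlgebra

variable {k : Type w} [Field k] {Q : Type u} [Quiver.{v} Q]
  {R : TwoSidedIdeal (PathAlgebra k Q)}

/-! ### Linear resolutions from the exactness of the Koszul complexes -/

section

variable {a : Q} {i j n r m : ℕ} {x : Fin r → Q} {z : Fin m → Q} {φ : Fin r → PathAlgebra k Q}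
  {ψ : Fin m → PathAlgebra k Q} {l : Fin m → Fin r → PathAlgebra k Q}

/-- The inclusion of K_{n+1} in kQ_1 K_n, written in bases, is the matrix of the Koszul
differential. -/
theorem IsKoszulBasis.exists_isLinearMatrix (hφ : IsKoszulBasis R a n x φ)
    (hψ : IsKoszulBasis R a (n + 1) z ψ) :
    ∃ l : Fin m → Fin r → PathAlgebra k Q, IsLinearMatrix z x l ∧ ∀ t, ψ t = ∑ s, l t s * φ s := by
  choose f hf hfx hs using fun t => hφ.exists_eq_sum (add_comm 1 n)
    (koszulPart_mono (Nat.zero_le 1) (hψ.mem t)) (hψ.mul_vtx t)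
  refine ⟨fun t s => vtx k (z t) * f t s, ⟨fun t s => vtx_mul_mem (hf t s) _,
    fun t s => by rw [← mul_assoc, vtx_mul_self], fun t s => by rw [mul_assoc, hfx]⟩, fun t => ?_⟩
  simp only [mul_assoc]
  rw [← Finset.mul_sum, ← hs, hψ.vtx_mul]

/-- In a decomposition in B + A, the term in A expands in the next basis and gives a boundary, and
the term in B gives coefficients in `R`. Cutting at `a` is needed because the decomposition need not
start there. -/
theorem IsKoszulBasis.exists_sub_rowMul_mem (hφ : IsKoszulBasis R a j x φ)
    (hψ : IsKoszulBasis R a (j + 1) z ψ) (hl : IsLinearMatrix z x l)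
    (hlψ : ∀ t, ψ t = ∑ s, l t s * φ s) (hn : i + 1 + j = n) {f : Fin r → PathAlgebra k Q}
    (hf : ∀ s, f s * vtx k (x s) = f s)
    (h : ∑ s, f s * φ s ∈ idealPart R (i + 1) n ⊔ koszulPart R i n) :
    ∃ f', ∀ s, f s - rowMul f' l s ∈ R := by
  obtain ⟨b, hb, c, hc, hbc⟩ := Submodule.mem_sup.1 h
  obtain ⟨f', -, -, hf'⟩ := hψ.exists_eq_sum (i := i) (n := n) (by omega)
    (koszulPart_mul_vtx hc a) (by rw [mul_assoc, vtx_mul_self])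
  refine ⟨f', hφ.mem_of_sum_mem hn (fun s => by rw [sub_mul, hf, hl.rowMul_mul_vtx]) ?_⟩
  convert! idealPart_mul_vtx hb a using 1
  simp only [sub_mul, Finset.sum_sub_distrib]
  rw [sum_rowMul_mul]
  simp only [← hlψ]
  rw [← hf', sub_eq_iff_eq_add, ← add_mul, hbc, Finset.sum_mul]
  simp only [mul_assoc, hφ.mul_vtx]

/-- Preimages of the homogeneous components add up, up to a degree bound common to all entries. -/
theorem exists_lift_rowMul_eq {f : Fin r → PathAlgebra k Q}
    (h : ∀ d, ∃ f', ∀ s, proj d (f s) - rowMul f' l s ∈ R) :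
    ∃ f', lift R x (rowMul f' l) = lift R x f := by
  choose f' hf' using h
  choose N hN using fun s => exists_eq_sum_proj (f s)
  set M := ∑ s, N s
  have hM : ∀ s, N s ≤ M := fun s => Finset.single_le_sum (fun _ _ => Nat.zero_le _)
    (Finset.mem_univ s)
  refine ⟨fun t => ∑ d ∈ Finset.range M, f' d t, (lift_eq_lift_of_sub_mem R fun s => ?_).symm⟩
  have h1 : f s - rowMul (fun t => ∑ d ∈ Finset.range M, f' d t) l s =
      ∑ d ∈ Finset.range M, (proj d (f s) - rowMul (f' d) l s) := by
    rw [Finset.sum_sub_distrib, ← hN s M (hM s)]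
    simp only [rowMul, Finset.sum_mul]
    rw [Finset.sum_comm]
  rw [h1]
  exact sum_mem fun d _ => hf' d s

end

/-- The Koszul complex of S_a is built from bases of the K_n e_a. Exactness is checked degree by
degree; in degree zero the differentials are injective, which is also the minimality of the
resolution. -/
theorem KoszulExact.isKoszul (hQ : LocallyFinite Q) (hR : IsQuadratic R) (hE : KoszulExact R) :
    IsKoszul R := by
  intro a
  choose r x φ hφ using exists_isKoszulBasis hQ R a
  choose l hl hlφ using fun n => (hφ n).exists_isLinearMatrix (hφ (n + 1))
  have hrow : ∀ n f, ∑ t, f t * φ (n + 1) t = ∑ s, rowMul f (l n) s * φ n s := fun n f => by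
    simp only [hlφ, sum_rowMul_mul f (φ n)]
  let aug : ProjSum R (x 0) →ₗ[Unital R] simpleModule R a :=
    (radical R (projModule R a)).mkQ ∘ₗ
      (LinearMap.proj (0 : Fin 1) : ProjSum R (fun _ : Fin 1 => a) →ₗ[Unital R] projModule R a) ∘ₗ
        mulMatrix R (x 0) (fun _ : Fin 1 => a) fun s _ => φ 0 s
  have haug : ∀ f, aug (lift R (x 0) f) = simpleClass R a (∑ s, f s * φ 0 s) := by
    intro f
    change (radical R (projModule R a)).mkQ (mulMatrix R (x 0) (fun _ : Fin 1 => a)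
      (fun s _ => φ 0 s) (lift R (x 0) f) 0) = _
    rw [simpleClass]
    congr 1
    refine Subtype.ext ?_
    change ∑ s, (lift R (x 0) f s : QuotientAlgebra R) * mk R (φ 0 s * vtx k a) = _
    rw [coe_projClass, Finset.sum_mul, mk_sum]
    refine Finset.sum_congr rfl fun s _ => ?_
    rw [coe_lift, ← mk_mul, mul_assoc, ← mul_assoc (vtx k (x 0 s)), (hφ 0).vtx_mul, mul_assoc]
  have haug0 : ∀ f, aug (lift R (x 0) f) = 0 ↔ ∑ s, proj 0 (f s) * φ 0 s = 0 := by
    intro f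
    rw [haug, ← simpleClass_zero, simpleClass_eq_iff hR, zero_mul, map_zero, Finset.sum_mul,
      map_sum]
    simp only [mul_assoc, (hφ 0).mul_vtx, proj_zero_mul, proj_eq_self ((hφ 0).mem _).1]
  -- The degree zero part of a kernel element is a scalar relation between basis elements, written
  -- with coefficients at vertices; as R_0 = 0, it is trivial.
  have hd0 : ∀ f, (∀ s, f s * vtx k (x 0 s) = f s) → aug (lift R (x 0) f) = 0 →
      ∀ s, proj 0 (f s) = 0 := by
    intro f hf h s
    refine hR.eq_zero ((hφ 0).mem_of_sum_mem (i := 0) (n := 0) (f := fun s => proj 0 (f s)) rfl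
      (fun s => ?_) ?_ s) two_pos
      (proj_mem 0 _)
    · rw [← proj_mul_vtx, hf]
    · rw [(haug0 f).1 h]
      exact zero_mem _
  have hdiff : ∀ n f, mulMatrix R (x (n + 1)) (x n) (l n) (lift R _ f) =
      lift R _ (rowMul f (l n)) := fun n => mulMatrix_lift R (hl n)
  -- The kernel condition, one degree at a time, is membership in R_{i+1} kQ_n.
  have hker : ∀ n f, mulMatrix R (x (n + 1)) (x n) (l n) (lift R _ f) = 0 →
      ∀ i, ∑ s, proj i (f s) * φ (n + 1) s ∈ idealPart R (i + 1) (i + 1 + n) := by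
    intro n f hf i
    rw [hdiff, lift_eq_zero_iff] at hf
    rw [hrow]
    refine (hφ n).sum_mem_idealPart rfl (fun s => ?_) ((hl n).rowMul_mem fun t => proj_mem i _)
    have := hR.proj_mem (hf s) (i + 1)
    rwa [(hl n).rowMul_mul_vtx, (hl n).proj_rowMul] at this
  -- In degree zero this membership is in R_1 kQ_n = 0, so independence of the basis applies without
  -- any exactness hypothesis.
  have hker0 : ∀ n f, (∀ s, f s * vtx k (x (n + 1) s) = f s) →
      mulMatrix R (x (n + 1)) (x n) (l n) (lift R _ f) = 0 → ∀ s, proj 0 (f s) = 0 := by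
    intro n f hf h s
    have h1 := hker n f h 0
    rw [zero_add, add_comm 1 n, idealPart_one_eq_bot hR, Submodule.mem_bot] at h1
    refine hR.eq_zero ((hφ (n + 1)).mem_of_sum_mem (i := 0) (n := n + 1)
      (f := fun s => proj 0 (f s)) (by omega) (fun s => ?_) ?_ s) two_pos (proj_mem 0 _)
    · rw [← proj_mul_vtx, hf]
    · rw [h1]
      exact zero_mem _
  refine ⟨⟨r, x, aug, fun n => mulMatrix R (x (n + 1)) (x n) (l n), ?_, ?_, ?_, ?_, ?_, ?_⟩⟩
  · intro b
    obtain ⟨f, hf, rfl⟩ := exists_eq_simpleClass b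
    obtain ⟨c, hc⟩ := (hφ 0).span (vtx k a) (by rw [koszulPart_eq (by omega)]; exact vtx_mem a)
      (vtx_mul_self a)
    refine ⟨lift R (x 0) fun s => c s • f, ?_⟩
    rw [haug]
    congr 1
    simp only [smul_mul_assoc, ← mul_smul_comm]
    rw [← Finset.mul_sum, ← hc, hf]
  · intro b
    obtain ⟨f, hf, rfl⟩ := exists_eq_lift R b
    constructor
    · intro h
      have h0 := hd0 f hf h
      suffices h1 : ∀ d, ∃ f', ∀ s, proj d (f s) - rowMul f' (l 0) s ∈ R by
        obtain ⟨f', hf'⟩ := exists_lift_rowMul_eq h1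
        exact ⟨lift R _ f', by rw [hdiff, hf']⟩
      intro d
      rcases d with - | d
      · refine ⟨0, fun s => ?_⟩
        rw [h0 s]
        simp [rowMul]
      -- Exactness at P^0 is automatic in positive degree, as kQ_d K_1 is all of kQ_{d+1}.
      · refine (hφ 0).exists_sub_rowMul_mem (i := d) (hφ 1) (hl 0) (hlφ 0) rfl
          (fun s => by rw [← proj_mul_vtx, hf]) (Submodule.mem_sup_right ?_)
        rw [koszulPart_eq (by omega)]
        exact Submodule.sum_mem _ fun s _ => mul_mem_degreePart (proj_mem _ _) ((hφ 0).mem s).1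
    · rintro ⟨b', hb'⟩
      obtain ⟨f', -, rfl⟩ := exists_eq_lift R b'
      rw [← hb', hdiff, haug0]
      exact Finset.sum_eq_zero fun s _ => by rw [(hl 0).proj_zero_rowMul, zero_mul]
  · intro n b
    obtain ⟨f, hf, rfl⟩ := exists_eq_lift R b
    constructor
    · intro h
      have h0 := hker0 n f hf h
      suffices h1 : ∀ d, ∃ f', ∀ s, proj d (f s) - rowMul f' (l (n + 1)) s ∈ R by
        obtain ⟨f', hf'⟩ := exists_lift_rowMul_eq h1
        exact ⟨lift R _ f', by rw [hdiff, hf']⟩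
      intro d
      rcases d with - | d
      · refine ⟨0, fun s => ?_⟩
        rw [h0 s]
        simp [rowMul]
      -- The only use of the Koszul inclusion: the cycle lies in A_{d+1} by its form, and in B_{d+2}
      -- by the kernel condition.
      · refine (hφ (n + 1)).exists_sub_rowMul_mem (i := d) (hφ (n + 2)) (hl (n + 1)) (hlφ (n + 1)) rfl
          (fun s => by rw [← proj_mul_vtx, hf]) (hE _ d (by omega) ⟨?_, ?_⟩)
        · exact (hφ (n + 1)).sum_mem_koszulPart rfl fun s => proj_mem _ _
        · have := hker n f h (d + 1)
          rwa [show d + 1 + 1 + n = d + 1 + (n + 1) by omega] at this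
    · rintro ⟨b', hb'⟩
      obtain ⟨f', -, rfl⟩ := exists_eq_lift R b'
      rw [← hb', hdiff, hdiff, lift_eq_zero_iff, rowMul_rowMul]
      refine fun s => R.mul_mem_right _ _ (sum_mem fun t _ => R.mul_mem_left _ _ ?_)
      -- The composite of two differentials vanishes because K_{n+2} lies in R_2 kQ_n, so the
      -- entries of the product matrix lie in `R`.
      refine (hφ n).mem_of_sum_mem (add_comm 2 n) ((hl n).rowMul_mul_vtx _) ?_ s
      rw [← hrow, ← hlφ]
      exact koszulPart_zero_le_idealPart _ ((hφ (n + 2)).mem t)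
  · intro b hb
    obtain ⟨f, hf, rfl⟩ := exists_eq_lift R b
    exact lift_mem_radical R (hd0 f hf hb)
  · intro n b hb
    obtain ⟨f, hf, rfl⟩ := exists_eq_lift R b
    exact lift_mem_radical R (hker0 n f hf hb)
  · intro n d b hb
    obtain ⟨f, -, hf, rfl⟩ := exists_eq_lift_of_homogeneous R hb
    rw [hdiff]
    exact isHomogeneousElement_lift R ((hl n).rowMul_mem hf)

theorem isKoszul_iff_koszulExact (hQ : LocallyFinite Q) (hR : IsQuadratic R) :
    IsKoszul R ↔ KoszulExact R :=
  ⟨IsKoszul.koszulExact hR, KoszulExact.isKoszul hQ hR⟩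

end

end BoundQuiver

theorem theorem3p9 {k : Type w} [Field k] {Q : Type u} [Quiver.{v} Q]
    (hQ : BoundQuiver.LocallyFinite Q)
    (R : TwoSidedIdeal (BoundQuiver.PathAlgebra k Q)) (hR : BoundQuiver.IsQuadratic R) :
    BoundQuiver.IsKoszul R ↔ BoundQuiver.IsKoszul (BoundQuiver.quadraticDual R) := by
  rw [BoundQuiver.isKoszul_iff_koszulExact hQ hR, BoundQuiver.isKoszul_iff_koszulExact hQ.op
    (BoundQuiver.isQuadratic_quadraticDual R), BoundQuiver.koszulExact_quadraticDual_iff hQ hR]
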